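/- **Setting.** All graphs are simple. A *decision function* $f(u,\mathbb G,\mathbf x)\in\{0,1\}$ is defined for every graph $\mathbb G$ on $[n]$, every vertex $u\in[n]$ and every $\mathbf x\in[0,1]^N$ with $N\ge n$, and is measurable in $\mathbf x$. It is an *independence function* if for all $\mathbb G$, $\mathbf x$ and all edges $(u,v)$ of $\mathbb G$, $f(u,\mathbb G,\mathbf x)=0$ or $f(v,\mathbb G,\mathbf x)=0$; then $I_{\mathbb G}(f,\mathbf x)=\{u: f(u,\mathbb G,\mathbf x)=1\}$ is an independent set. Let $B_{\mathbb G}(u,r)$ be the subgraph of $\mathbb G$ induced by the vertices at distance at most $r$ from $u$. The function $f$ is *$r$-local* if $f(u_1,\mathbb G_1,\mathbf x^{(1)})=f(u_2,\mathbb G_2,\mathbf x^{(2)})$ whenever there is a graph isomorphism $\pi:B_{\mathbb G_1}(u_1,r)\to B_{\mathbb G_2}(u_2,r)$ with $\pi(u_1)=u_2$ and $x^{(1)}_v=x^{(2)}_{\pi(v)}$ for every vertex $v$ of $B_{\mathbb G_1}(u_1,r)$. Let $\mathbb T_{d,r}$ be the $d$-regular rooted tree of depth $r$ (the root has $d$ children,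 every other vertex at depth less than $r$ has $d-1$ children) on the vertex set $\{1,\dots,n_{d,r}\}$ with root $1$, where $n_{d,r}=1+d\sum_{i<r}(d-1)^i$; write $f(\mathbf x)=f(1,\mathbb T_{d,r},\mathbf x)$ and $\alpha(f)=\mathbb E[f(\mathbf X)]$ for $\mathbf X$ uniform on $[0,1]^{n_{d,r}}$. For $nd$ even, $\mathbb G_d(n)$ is a uniformly random $d$-regular graph on $[n]$. For $p\in[0,1]$, the *$p$-correlated distribution* on $[0,1]^n\times[0,1]^n$ is the law of $(\mathbf X,\mathbf Y)$, where $\mathbf X,\mathbf Z$ are independent and uniform on $[0,1]^n$ and, independently for every coordinate $u$, $Y_u=X_u$ with probability $p$ and $Y_u=Z_u$ with probability $1-p$. Let $\gamma(p)=\mathbb P(f(\mathbf X)=f(\mathbf Y)=1)$ for $p$-correlated $(\mathbf X,\mathbf Y)$ on $[0,1]^{n_{d,r}}\times[0,1]^{n_{d,r}}$. **Theorem 2.7.** Fix a positive integer $d$ and an integer $r\ge 0$, let $f_r$ be an $r$-local independence function, and let $\alpha=\alpha(f_r)$. Then: 1. The overlap density $p\mapsto\gamma(p)$ is continuous on $[0,1]$.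 2. For every $n$ and every $p\in[0,1]$, both marginals of the $p$-correlated distribution are uniform on $[0,1]^n$. 3. For every $\gamma\in[\alpha^2,\alpha]$ there is $p\in[0,1]$ with $\gamma(p)=\gamma$ such that for every $\epsilon>0$ and all sufficiently large $n$ with $nd$ even, $$\mathbb P\Bigl(\bigl|I_{\mathbb G_d(n)}(f_r,\mathbf X)\cap I_{\mathbb G_d(n)}(f_r,\mathbf Y)\bigr|\notin[(\gamma-\epsilon)n,(\gamma+\epsilon)n]\Bigr)\le\epsilon,$$ where $(\mathbf X,\mathbf Y)$ is $p$-correlated on $[0,1]^n\times[0,1]^n$ and independent of $\mathbb G_d(n)$. -/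

import Mathlib

open MeasureTheory ProbabilityTheory
open scoped unitInterval

namespace LocalAlg

/-- A decision function `f(u, G, x)`: here `G` is a graph on `n` vertices, `u` is a vertex of `G`,
and `x ∈ [0,1]^N` is a sequence of seeds with `N ≥ n`. It is Boolean-valued, and measurable
in the seeds. -/
structure DecisionFunction where
  /-- the decision at the vertex `u` -/
  toFun : {n N : ℕ} → n ≤ N → Fin n → SimpleGraph (Fin n) → (Fin N → I) → Bool
  measurable_toFun : ∀ {n N : ℕ} (h : n ≤ N) (u : Fin n) (G : SimpleGraph (Fin n)),
    Measurable (toFun h u G)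

/-- The set `{u | f(u, G, x) = 1}` returned by a decision function. -/
def DecisionFunction.output (f : DecisionFunction) {n N : ℕ} (h : n ≤ N)
    (G : SimpleGraph (Fin n)) (x : Fin N → I) : Finset (Fin n) :=
  Finset.univ.filter fun u => f.toFun h u G x = true

/-- `f` is an independence function: on every graph and for every sequence of seeds, of two
adjacent vertices at least one is decided `0`. -/
def DecisionFunction.IsIndependence (f : DecisionFunction) : Prop :=
  ∀ {n N : ℕ} (h : n ≤ N) (G : SimpleGraph (Fin n)) (x : Fin N → I) (u v : Fin n),
    G.Adj u v → f.toFun h u G x = false ∨ f.toFun h v G x = false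

/-- The vertices at distance at most `r` from `u` (the extended distance is infinite between
different components). -/
def nbhd {V : Type*} (G : SimpleGraph V) (u : V) (r : ℕ) : Set V :=
  {v | G.edist u v ≤ (r : ℕ∞)}

theorem self_mem_nbhd {V : Type*} (G : SimpleGraph V) (u : V) (r : ℕ) : u ∈ nbhd G u r := by
  simp [nbhd]

/-- `f` is `r`-local: whenever an isomorphism between the depth-`r` neighbourhoods (as induced
subgraphs) of `u₁` in `G₁` and of `u₂` in `G₂` maps `u₁` to `u₂` and carries the seeds in the
first neighbourhood to the seeds in the second one, the two decisions agree. -/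
def DecisionFunction.IsLocal (f : DecisionFunction) (r : ℕ) : Prop :=
  ∀ {n₁ N₁ n₂ N₂ : ℕ} (h₁ : n₁ ≤ N₁) (h₂ : n₂ ≤ N₂)
    (G₁ : SimpleGraph (Fin n₁)) (G₂ : SimpleGraph (Fin n₂)) (u₁ : Fin n₁) (u₂ : Fin n₂)
    (π : G₁.induce (nbhd G₁ u₁ r) ≃g G₂.induce (nbhd G₂ u₂ r))
    (x₁ : Fin N₁ → I) (x₂ : Fin N₂ → I),
    (π ⟨u₁, self_mem_nbhd G₁ u₁ r⟩ : Fin n₂) = u₂ →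
    (∀ v : nbhd G₁ u₁ r, x₁ (Fin.castLE h₁ v) = x₂ (Fin.castLE h₂ (π v))) →
    f.toFun h₁ u₁ G₁ x₁ = f.toFun h₂ u₂ G₂ x₂

/-- The number `1 + d + d(d-1) + ⋯ + d(d-1)^(r-1)` of vertices of the `d`-regular rooted tree
of depth `r`. -/
def treeSize (d r : ℕ) : ℕ := 1 + d * ∑ i ∈ Finset.range r, (d - 1) ^ i

theorem treeSize_pos (d r : ℕ) : 0 < treeSize d r := by
  unfold treeSize; omega

/-- The parent of the vertex `w ≥ 1` when the vertices of the `d`-regular rooted tree are numbered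
`0, 1, 2, …` in breadth-first order: the children of the root `0` are `1, …, d`, and the children
of `v ≥ 1` are the `d - 1` vertices `d + (v-1)(d-1) + 1, …, d + v(d-1)`. -/
def treeParent (d w : ℕ) : ℕ := if w ≤ d then 0 else 1 + (w - 1 - d) / (d - 1)

/-- The `d`-regular rooted tree of depth `r`: the root has `d` children, and every
other vertex at depth less than `r` has `d - 1` children. -/
def regularTree (d r : ℕ) : SimpleGraph (Fin (treeSize d r)) :=
  SimpleGraph.fromRel fun v w => 0 < (w : ℕ) ∧ (v : ℕ) = treeParent d w

/-- The root of the tree. -/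
def treeRoot (d r : ℕ) : Fin (treeSize d r) := ⟨0, treeSize_pos d r⟩

/-- The decision `f(x)` at the root of the `d`-regular tree of depth `r` with seeds `x`. -/
def DecisionFunction.onTree (f : DecisionFunction) (d r : ℕ)
    (x : Fin (treeSize d r) → I) : Bool :=
  f.toFun le_rfl (treeRoot d r) (regularTree d r) x

/-- The density `α(f)`: the probability (equivalently, the expectation of the 0/1 value) that `f`
decides `1` at the root of the tree when the seeds are i.i.d. uniform on `[0,1]`. -/
noncomputable def DecisionFunction.density (f : DecisionFunction) (d r : ℕ) : ℝ :=
  (volume : Measure (Fin (treeSize d r) → I)).real {x | f.onTree d r x = true}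

/-- The second vector of a `p`-correlated pair: `Y_u = X_u` if `W_u ≤ p`, and `Y_u = Z_u`
otherwise. -/
noncomputable def mix {n : ℕ} (p : I) (x z w : Fin n → I) : Fin n → I :=
  fun u => if w u ≤ p then x u else z u

/-- The `p`-correlated distribution on `[0,1]^n × [0,1]^n`: the law of `(X, Y)` where
`X, Z` are independent uniform vectors and, independently for each coordinate `u`,
`Y_u = X_u` with probability `p` and `Y_u = Z_u` with probability `1 - p`. The choice is made by
an independent uniform vector `W`, through the events `W_u ≤ p`. -/
noncomputable def correlated (n : ℕ) (p : I) : Measure ((Fin n → I) × (Fin n → I)) :=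
  (volume : Measure ((Fin n → I) × (Fin n → I) × (Fin n → I))).map
    fun t => (t.1, mix p t.1 t.2.1 t.2.2)

/-- The overlap density `γ(p)`: the probability that `f(X) = 1` and `f(Y) = 1` at the root of the
tree, for `p`-correlated seeds `(X, Y)`. -/
noncomputable def DecisionFunction.overlapDensity (f : DecisionFunction) (d r : ℕ) (p : I) : ℝ :=
  (correlated (treeSize d r) p).real {t | f.onTree d r t.1 = true ∧ f.onTree d r t.2 = true}

open Classical in
/-- The random regular graph `𝔾_d(n)`: the uniform distribution on the set of all `d`-regular
simple graphs on `n` labelled vertices (it is a probability measure when there is such a graph,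
that is, when `d < n` and `n * d` is even). -/
noncomputable def randomRegularGraph (d n : ℕ) : Measure (SimpleGraph (Fin n)) :=
  uniformOn {G : SimpleGraph (Fin n) | G.IsRegularOfDegree d}

end LocalAlg

/-! All `p`-correlated pairs live on one probability space, through the thresholds `w u ≤ p`. Off
the null event of a tie `w u = p` the second vector is locally constant in `p`, so dominated
convergence makes the overlap density continuous although decisions are only measurable in the
seeds. Its values at `0` and `1` are `α²` and `α`, and the intermediate value theorem supplies `p`
(`exists_overlapDensity_eq`).

For fixed `p`, concentration has three ingredients. Few vertices of a random regular graph are near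
a short cycle: switching a short-cycle edge with a remote edge is injective and lands in a small set
(`card_isShortCycleEdge_mul_le`). At every other vertex the `r`-ball is the regular tree
(`TreeLike.exists_iso`), so by locality the expected overlap is `γ(p) n` up to the number of
exceptional vertices. Decisions at vertices more than `2r` apart read disjoint seeds, so the
variance is `O(n)` and Chebyshev's inequality applies on each typical graph
(`correlated_atypicalSeeds_le`). -/

namespace LocalAlg

/-! ### Correlated pairs as functions of i.i.d. triples, and their marginals -/

/-- The second member of a correlated pair at one coordinate, where the source of randomness is
the triple `t = (x, z, w)`. -/
noncomputable def mixOne (p : I) (t : I × I × I) : I := if t.2.2 ≤ p then t.1 else t.2.1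

theorem measurable_mixOne (p : I) : Measurable (mixOne p) := by
  unfold mixOne
  exact Measurable.ite (measurableSet_le (by fun_prop) (by fun_prop)) (by fun_prop) (by fun_prop)

/-- A `p`-correlated pair, as a function of a sequence of independent triples. -/
noncomputable def pairOf {n : ℕ} (p : I) (ω : Fin n → I × I × I) : (Fin n → I) × (Fin n → I) :=
  (fun i => (ω i).1, fun i => mixOne p (ω i))

theorem measurable_pairOf {n : ℕ} (p : I) : Measurable (pairOf (n := n) p) := by
  have := measurable_mixOne p
  unfold pairOf
  fun_prop

theorem measurable_mix {n : ℕ} (p : I) :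
    Measurable fun t : (Fin n → I) × (Fin n → I) × (Fin n → I) =>
      (t.1, mix p t.1 t.2.1 t.2.2) := by
  have := measurable_mixOne p
  have h : (fun t : (Fin n → I) × (Fin n → I) × (Fin n → I) => (t.1, mix p t.1 t.2.1 t.2.2)) =
      fun t => (t.1, fun u => mixOne p (t.1 u, t.2.1 u, t.2.2 u)) := rfl
  rw [h]
  fun_prop

/-- Regrouping the three vectors into one vector of triples makes the pair at a coordinate a
function of that coordinate alone, so independence and reindexing apply directly. -/
theorem correlated_eq_map_pairOf (n : ℕ) (p : I) :
    correlated n p = (volume : Measure (Fin n → I × I × I)).map (pairOf p) := by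
  have h1 : MeasurePreserving (MeasurableEquiv.arrowProdEquivProdArrow I (I × I) (Fin n))
      volume volume :=
    measurePreserving_arrowProdEquivProdArrow I (I × I) (Fin n) (fun _ => volume) fun _ => volume
  have h2 : MeasurePreserving (MeasurableEquiv.arrowProdEquivProdArrow I I (Fin n))
      volume volume :=
    measurePreserving_arrowProdEquivProdArrow I I (Fin n) (fun _ => volume) fun _ => volume
  have h3 := ((MeasurePreserving.id (volume : Measure (Fin n → I))).prod h2).comp h1
  have h4 : (volume : Measure ((Fin n → I) × (Fin n → I) × (Fin n → I))) =
      (volume : Measure (Fin n → I)).prod volume := rfl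
  rw [correlated, h4, ← h3.map_eq, Measure.map_map (measurable_mix p) h3.measurable]
  rfl

instance (n : ℕ) (p : I) : IsProbabilityMeasure (correlated n p) :=
  Measure.isProbabilityMeasure_map (measurable_mix p).aemeasurable

/-- Split according to `w ≤ p`: the two pieces have measure `|S|·p` and `|S|·(1-p)`, since `w` is
independent of `x` and `z`. -/
theorem map_mixOne (p : I) : (volume : Measure (I × I × I)).map (mixOne p) = volume := by
  ext S hS
  rw [Measure.map_apply (measurable_mixOne p) hS]
  have hsplit : mixOne p ⁻¹' S =
      (S ×ˢ (Set.univ ×ˢ Set.Iic p)) ∪ (Set.univ ×ˢ (S ×ˢ Set.Ioi p)) := by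
    ext ⟨x, z, w⟩
    by_cases h : w ≤ p
    · simp [mixOne, h]
    · simp [mixOne, h, not_le.mp h]
  have hdisj : Disjoint (S ×ˢ (Set.univ ×ˢ Set.Iic p)) (Set.univ ×ˢ (S ×ˢ Set.Ioi p)) := by
    rw [Set.disjoint_left]
    rintro ⟨x, z, w⟩ h1 h2
    simp only [Set.mem_prod, Set.mem_Iic, Set.mem_Ioi] at h1 h2
    exact absurd h1.2.2 (not_le.mpr h2.2.2)
  rw [hsplit, measure_union hdisj (by measurability)]
  simp only [Measure.volume_eq_prod, Measure.prod_prod, measure_univ, one_mul]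
  rw [← mul_add, ← measure_union (Set.Iic_disjoint_Ioi le_rfl) measurableSet_Ioi,
    Set.Iic_union_Ioi, measure_univ, mul_one]

theorem map_fst_correlated (n : ℕ) (p : I) : (correlated n p).map Prod.fst = volume := by
  rw [correlated, Measure.map_map measurable_fst (measurable_mix p)]
  exact (measurePreserving_fst (μ := (volume : Measure (Fin n → I)))
    (ν := (volume : Measure ((Fin n → I) × (Fin n → I))))).map_eq

theorem map_snd_correlated (n : ℕ) (p : I) : (correlated n p).map Prod.snd = volume := by
  rw [correlated_eq_map_pairOf, Measure.map_map measurable_snd (measurable_pairOf p)]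
  have hs : SigmaFinite ((volume : Measure (I × I × I)).map (mixOne p)) := by
    rw [map_mixOne]; infer_instance
  have h := Measure.pi_map_pi (μ := fun _ : Fin n => (volume : Measure (I × I × I)))
    (f := fun _ => mixOne p) fun _ => (measurable_mixOne p).aemeasurable
  simp only [map_mixOne] at h
  exact h

/-! ### Continuity and end values of the overlap density -/

theorem measurableSet_onTree (f : DecisionFunction) (d r : ℕ) :
    MeasurableSet {x | f.onTree d r x = true} :=
  f.measurable_toFun le_rfl (treeRoot d r) (regularTree d r) (measurableSet_singleton true)

theorem measurableSet_onTree_pair (f : DecisionFunction) (d r : ℕ) :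
    MeasurableSet {t : (Fin (treeSize d r) → I) × (Fin (treeSize d r) → I) |
      f.onTree d r t.1 = true ∧ f.onTree d r t.2 = true} :=
  (measurable_fst (measurableSet_onTree f d r)).inter
    (measurable_snd (measurableSet_onTree f d r))

theorem ae_forall_seed_ne (n : ℕ) (p : I) :
    ∀ᵐ t : (Fin n → I) × (Fin n → I) × (Fin n → I), ∀ u, t.2.2 u ≠ p := by
  rw [ae_all_iff]
  intro u
  have h : MeasurePreserving (fun t : (Fin n → I) × (Fin n → I) × (Fin n → I) => t.2.2 u)
      volume volume :=
    (measurePreserving_eval (fun _ : Fin n => (volume : Measure I)) u).comp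
      ((measurePreserving_snd (μ := (volume : Measure (Fin n → I)))
        (ν := (volume : Measure (Fin n → I)))).comp
      (measurePreserving_snd (μ := (volume : Measure (Fin n → I)))
        (ν := (volume : Measure ((Fin n → I) × (Fin n → I))))))
  exact h.quasiMeasurePreserving.ae (Measure.ae_ne volume p)

/-- Without ties, each of the finitely many comparisons `w u ≤ q` is constant for `q` near `p`. The
pair itself is then locally constant, so no continuity of the decision is needed. -/
theorem eventually_mix_eq {n : ℕ} (x z w : Fin n → I) (p : I) (h : ∀ u, w u ≠ p) :
    ∀ᶠ q in nhds p, mix q x z w = mix p x z w := by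
  have h' : ∀ᶠ q in nhds p, ∀ u, (w u ≤ q ↔ w u ≤ p) := by
    rw [Filter.eventually_all]
    intro u
    rcases lt_or_gt_of_ne (h u) with hu | hu
    · filter_upwards [eventually_gt_nhds hu] with q hq
      exact ⟨fun _ => hu.le, fun _ => hq.le⟩
    · filter_upwards [eventually_lt_nhds hu] with q hq
      exact ⟨fun hq' => absurd hq (not_lt.mpr hq'), fun hp' => absurd hu (not_lt.mpr hp')⟩
  filter_upwards [h'] with q hq
  funext u
  simp only [mix, hq u]

/-- The set of triples whose correlated pair is decided `(1, 1)`. -/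
def overlapSet (f : DecisionFunction) (d r : ℕ) (p : I) :
    Set ((Fin (treeSize d r) → I) × (Fin (treeSize d r) → I) × (Fin (treeSize d r) → I)) :=
  {t | f.onTree d r t.1 = true ∧ f.onTree d r (mix p t.1 t.2.1 t.2.2) = true}

theorem measurableSet_overlapSet (f : DecisionFunction) (d r : ℕ) (p : I) :
    MeasurableSet (overlapSet f d r p) :=
  measurable_mix p (measurableSet_onTree_pair f d r)

theorem overlapDensity_eq (f : DecisionFunction) (d r : ℕ) (p : I) :
    f.overlapDensity d r p = volume.real (overlapSet f d r p) := by
  rw [DecisionFunction.overlapDensity, correlated,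
    map_measureReal_apply (measurable_mix p) (measurableSet_onTree_pair f d r)]
  rfl

theorem continuous_overlapDensity (f : DecisionFunction) (d r : ℕ) :
    Continuous (f.overlapDensity d r) := by
  have h : f.overlapDensity d r =
      fun p => ∫ t, (overlapSet f d r p).indicator (fun _ => (1 : ℝ)) t := by
    funext p
    rw [overlapDensity_eq, integral_indicator_const _ (measurableSet_overlapSet f d r p)]
    simp
  rw [h, continuous_iff_continuousAt]
  intro p
  refine continuousAt_of_dominated (bound := fun _ => 1)
    (.of_forall fun q => ?_) (.of_forall fun q => .of_forall fun t => ?_) (integrable_const _) ?_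
  · exact (stronglyMeasurable_const.indicator
      (measurableSet_overlapSet f d r q)).aestronglyMeasurable
  · exact (norm_indicator_le_norm_self _ _).trans (by simp)
  · filter_upwards [ae_forall_seed_ne (treeSize d r) p] with t ht
    refine Filter.EventuallyEq.continuousAt (y := (overlapSet f d r p).indicator 1 t) ?_
    filter_upwards [eventually_mix_eq t.1 t.2.1 t.2.2 p ht] with q hq
    simp only [overlapSet, Set.indicator, Set.mem_ofPred_eq, hq, Pi.one_apply]
    congr

theorem overlapDensity_one (f : DecisionFunction) (d r : ℕ) :
    f.overlapDensity d r 1 = f.density d r := by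
  rw [overlapDensity_eq, DecisionFunction.density]
  have h : overlapSet f d r 1 = Prod.fst ⁻¹' {x | f.onTree d r x = true} := by
    ext t
    have : mix 1 t.1 t.2.1 t.2.2 = t.1 := by
      funext u
      simp [mix, unitInterval.le_one']
    simp [overlapSet, this]
  rw [h]
  exact (measurePreserving_fst (μ := (volume : Measure (Fin (treeSize d r) → I)))
    (ν := volume)).measureReal_preimage (measurableSet_onTree f d r).nullMeasurableSet

theorem overlapDensity_zero (f : DecisionFunction) (d r : ℕ) :
    f.overlapDensity d r 0 = f.density d r ^ 2 := by
  rw [overlapDensity_eq, DecisionFunction.density]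
  set A := {x | f.onTree d r x = true}
  -- Only almost everywhere: a seed `w u = 0` still selects `x u` at `p = 0`.
  have h : overlapSet f d r 0 =ᵐ[volume] A ×ˢ (A ×ˢ Set.univ) := by
    filter_upwards [ae_forall_seed_ne (treeSize d r) 0] with t ht
    have : mix 0 t.1 t.2.1 t.2.2 = t.2.1 := by
      funext u
      have : ¬ t.2.2 u ≤ 0 := fun h => ht u (le_antisymm h unitInterval.nonneg')
      simp [mix, this]
    apply propext
    change (_ ∧ f.onTree d r (mix 0 t.1 t.2.1 t.2.2) = true) ↔ t ∈ A ×ˢ (A ×ˢ Set.univ)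
    rw [this]
    simp [A, Set.mem_prod]
  rw [measureReal_congr h]
  simp only [Measure.volume_eq_prod, measureReal_prod_prod, probReal_univ]
  ring

theorem exists_overlapDensity_eq (f : DecisionFunction) (d r : ℕ) {γ : ℝ}
    (hγ : γ ∈ Set.Icc (f.density d r ^ 2) (f.density d r)) :
    ∃ p, f.overlapDensity d r p = γ :=
  mem_range_of_exists_le_of_exists_ge (continuous_overlapDensity f d r)
    ⟨0, (overlapDensity_zero f d r).trans_le hγ.1⟩ ⟨1, hγ.2.trans (overlapDensity_one f d r).ge⟩

/-! ### Independence on product spaces and the second moment bound -/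

/-- Reindexing an i.i.d. sequence by an injection gives an i.i.d. sequence. -/
theorem measurePreserving_comp_injective {n m : ℕ} {Ω : Type*} [MeasureSpace Ω]
    [IsProbabilityMeasure (volume : Measure Ω)] {φ : Fin m → Fin n} (hφ : Function.Injective φ) :
    MeasurePreserving (fun (ω : Fin n → Ω) i => ω (φ i)) volume volume := by
  refine ⟨by fun_prop, ?_⟩
  have h : iIndepFun (fun (i : Fin n) (ω : Fin n → Ω) => ω i) volume :=
    iIndepFun_pi (μ := fun _ : Fin n => (volume : Measure Ω)) (X := fun _ => id)
      fun _ => aemeasurable_id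
  have h' := h.precomp hφ
  rw [iIndepFun_iff_map_fun_eq_pi_map fun i => (measurable_pi_apply _).aemeasurable] at h'
  rw [h']
  have hm (i : Fin n) : (volume : Measure (Fin n → Ω)).map (fun ω => ω i) = volume :=
    (measurePreserving_eval (fun _ : Fin n => (volume : Measure Ω)) i).map_eq
  simp only [hm]
  rfl

/-- Filling the coordinates outside `S` with a constant factors `F` measurably through the block
`S`, and likewise `G` through `T`; disjoint blocks of i.i.d. coordinates are independent. -/
theorem indepFun_of_dependsOn {n : ℕ} {Ω α β : Type*} [MeasureSpace Ω] [Nonempty Ω]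
    [IsProbabilityMeasure (volume : Measure Ω)] [MeasurableSpace α] [MeasurableSpace β]
    {F : (Fin n → Ω) → α} {G : (Fin n → Ω) → β} (hF : Measurable F) (hG : Measurable G)
    {S T : Finset (Fin n)} (hST : Disjoint S T) (hFS : DependsOn F (S : Set (Fin n)))
    (hGT : DependsOn G (T : Set (Fin n))) :
    IndepFun F G volume := by
  classical
  let c : Ω := Classical.arbitrary Ω
  let ext (S : Finset (Fin n)) (y : S → Ω) : Fin n → Ω := fun i =>
    if h : i ∈ S then y ⟨i, h⟩ else c
  have hext (S : Finset (Fin n)) : Measurable (ext S) := by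
    refine measurable_pi_iff.mpr fun i => ?_
    by_cases h : i ∈ S
    · simpa [ext, h] using measurable_pi_apply _
    · simp [ext, h]
  have h : iIndepFun (fun (i : Fin n) (ω : Fin n → Ω) => ω i) volume :=
    iIndepFun_pi (μ := fun _ : Fin n => (volume : Measure Ω)) (X := fun _ => id)
      fun _ => aemeasurable_id
  have h' := (h.indepFun_finset S T hST fun i => by fun_prop).comp
    (hF.comp (hext S)) (hG.comp (hext T))
  convert h' using 1
  · funext ω
    exact hFS fun i hi => by simp [ext, Finset.mem_coe.mp hi]
  · funext ω
    exact hGT fun i hi => by simp [ext, Finset.mem_coe.mp hi]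

open Classical in
/-- A second moment bound for the number of events that occur, when all but few pairs of events
are independent. -/
theorem measure_card_dist_le {Ω ι : Type*} [Fintype ι] [MeasurableSpace Ω] {μ : Measure Ω}
    [IsProbabilityMeasure μ] {A : ι → Set Ω} (hA : ∀ i, MeasurableSet (A i)) (D : ι → Finset ι)
    {B : ℝ} (hB : ∀ i, ((D i).card : ℝ) ≤ B)
    (hind : ∀ i j, j ∉ D i → IndepFun ((A i).indicator fun _ => (1 : ℝ))
      ((A j).indicator fun _ => (1 : ℝ)) μ)
    {m δ : ℝ} (hδ : 0 < δ) (hm : |∑ i, μ.real (A i) - m| ≤ δ) :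
    μ {ω | 2 * δ < |((Finset.univ.filter fun i => ω ∈ A i).card : ℝ) - m|} ≤
      ENNReal.ofReal (Fintype.card ι * B / δ ^ 2) := by
  set X : ι → Ω → ℝ := fun i => (A i).indicator fun _ => (1 : ℝ) with hX
  have hbd (i : ι) (ω : Ω) : ‖X i ω‖ ≤ 1 :=
    (norm_indicator_le_norm_self _ _).trans (by simp)
  have hmeas (i : ι) : Measurable (X i) := measurable_const.indicator (hA i)
  have hL2 (i : ι) : MemLp (X i) 2 μ :=
    MemLp.of_bound (hmeas i).aestronglyMeasurable 1 (.of_forall (hbd i))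
  have hint (i : ι) : ∫ ω, X i ω ∂μ = μ.real (A i) := by
    rw [hX, integral_indicator_const _ (hA i)]
    simp
  have hcov (i j : ι) : cov[X i, X j; μ] ≤ if j ∈ D i then 1 else 0 := by
    split_ifs with h
    · rw [covariance_eq_sub (hL2 i) (hL2 j), hint, hint]
      have h1 : ∫ ω, (X i * X j) ω ∂μ ≤ ∫ _, (1 : ℝ) ∂μ := by
        refine integral_mono_of_nonneg (.of_forall fun ω => ?_) (integrable_const _)
          (.of_forall fun ω => ?_)
        · exact mul_nonneg (Set.indicator_nonneg (fun _ _ => zero_le_one) _)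
            (Set.indicator_nonneg (fun _ _ => zero_le_one) _)
        · have := mul_le_mul (hbd i ω) (hbd j ω) (norm_nonneg _) zero_le_one
          rw [← norm_mul, one_mul] at this
          exact (Real.le_norm_self _).trans this
      have h2 : 0 ≤ μ.real (A i) * μ.real (A j) := by positivity
      simp only [integral_const, probReal_univ, smul_eq_mul, mul_one] at h1
      linarith
    · exact ((hind i j h).covariance_eq_zero (hL2 i) (hL2 j)).le
  have hvar : Var[∑ i, X i; μ] ≤ Fintype.card ι * B := by
    rw [variance_sum hL2]
    calc ∑ i, ∑ j, cov[X i, X j; μ] ≤ ∑ i, ∑ j, (if j ∈ D i then 1 else 0 : ℝ) :=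
          Finset.sum_le_sum fun i _ => Finset.sum_le_sum fun j _ => hcov i j
      _ ≤ ∑ _i : ι, B := Finset.sum_le_sum fun i _ => by simpa using hB i
      _ = Fintype.card ι * B := by simp
  have hsum (ω : Ω) :
      (∑ i, X i) ω = ((Finset.univ.filter fun i => ω ∈ A i).card : ℝ) := by
    simp [hX, Finset.sum_apply, Set.indicator_apply]
  have hmean : ∫ ω, (∑ i, X i) ω ∂μ = ∑ i, μ.real (A i) := by
    simp only [Finset.sum_apply]
    rw [integral_finsetSum _ fun i _ => (hL2 i).integrable (by norm_num)]
    exact Finset.sum_congr rfl fun i _ => hint i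
  calc μ {ω | 2 * δ < |((Finset.univ.filter fun i => ω ∈ A i).card : ℝ) - m|}
      ≤ μ {ω | δ ≤ |(∑ i, X i) ω - ∫ ω, (∑ i, X i) ω ∂μ|} := by
        -- The mean is within `δ` of `m`, so a deviation above `2δ` from `m` is one above `δ` from
        -- the mean.
        refine measure_mono fun ω hω => ?_
        simp only [Set.mem_ofPred_eq] at hω ⊢
        rw [hmean, hsum]
        have := abs_sub_le ((Finset.univ.filter fun i => ω ∈ A i).card : ℝ)
          (∑ i, μ.real (A i)) m
        linarith
    _ ≤ ENNReal.ofReal (Var[∑ i, X i; μ] / δ ^ 2) :=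
        meas_ge_le_variance_div_sq (memLp_finsetSum' _ fun i _ => hL2 i) hδ
    _ ≤ ENNReal.ofReal (Fintype.card ι * B / δ ^ 2) := by gcongr

/-! ### Double counting and edge switchings -/

open Classical in
/-- The pairs `(x, y)` with `x ∈ s` that satisfy `P`. -/
noncomputable def pairs {α β : Type*} [Fintype β] (s : Finset α) (P : α → β → Prop) :
    Finset (α × β) :=
  (s ×ˢ Finset.univ).filter fun x => P x.1 x.2

theorem mem_pairs {α β : Type*} [Fintype β] {s : Finset α} {P : α → β → Prop} {x : α × β} :
    x ∈ pairs s P ↔ x.1 ∈ s ∧ P x.1 x.2 := by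
  simp [pairs]

open Classical in
theorem card_pairs {α β : Type*} [Fintype β] (s : Finset α) (P : α → β → Prop) :
    (pairs s P).card = ∑ x ∈ s, (Finset.univ.filter fun y => P x y).card := by
  simp only [pairs, Finset.card_filter, Finset.sum_product]

open Classical in
theorem card_pairs_le {α β : Type*} [Fintype β] (s : Finset α)
    (P : α → β → Prop) {K : ℕ} (h : ∀ x ∈ s, (Finset.univ.filter fun y => P x y).card ≤ K) :
    (pairs s P).card ≤ s.card * K := by
  rw [card_pairs]
  exact Finset.sum_le_card_nsmul _ _ _ h

open Classical in
theorem le_card_pairs {α β : Type*} [Fintype β] (s : Finset α)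
    (P : α → β → Prop) {K : ℕ} (h : ∀ x ∈ s, K ≤ (Finset.univ.filter fun y => P x y).card) :
    s.card * K ≤ (pairs s P).card := by
  rw [card_pairs]
  exact Finset.card_nsmul_le_sum _ _ _ h

section Graph

open SimpleGraph

variable {V : Type*}

theorem exists_adj_edist_le_of_edist_le_succ {G : SimpleGraph V} {u v : V} {k : ℕ} (huv : u ≠ v)
    (h : G.edist u v ≤ (k + 1 : ℕ)) : ∃ w, G.edist u w ≤ k ∧ G.Adj w v := by
  obtain ⟨p, hp⟩ := exists_walk_of_edist_ne_top (ne_top_of_le_ne_top (ENat.natCast_ne_top _) h)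
  rw [← hp, Nat.cast_le] at h
  have hnil : ¬ p.Nil := fun hn => huv hn.eq
  refine ⟨p.penultimate, (edist_le p.dropLast).trans ?_, p.adj_penultimate hnil⟩
  have : p.dropLast.length + 1 = p.length := Walk.length_dropLast_add_one hnil
  exact_mod_cast (by omega : p.dropLast.length ≤ k)

theorem edist_le_succ_of_adj {G : SimpleGraph V} {u v w : V} {k : ℕ}
    (h : G.edist u v ≤ k) (hvw : G.Adj v w) : G.edist u w ≤ (k + 1 : ℕ) := by
  push_cast
  exact G.edist_triangle.trans (add_le_add h (edist_eq_one_iff_adj.mpr hvw).le)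

/-- The edge `ab` lies on a cycle of length at most `L + 1`. -/
def IsShortCycleEdge (G : SimpleGraph V) (L : ℕ) (a b : V) : Prop :=
  G.Adj a b ∧ (G.deleteEdges {s(a, b)}).edist a b ≤ L

/-- Replace the edges `ab`, `ce` by `ac`, `be`. -/
def switch (G : SimpleGraph V) (a b c e : V) : SimpleGraph V :=
  G.deleteEdges {s(a, b), s(c, e)} ⊔ fromEdgeSet {s(a, c), s(b, e)}

/-- The edges `ab` and `ce` can be replaced by `ac` and `be`. -/
structure Switchable (G : SimpleGraph V) (a b c e : V) : Prop where
  adj_ab : G.Adj a b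
  adj_ce : G.Adj c e
  not_adj_ac : ¬ G.Adj a c
  not_adj_be : ¬ G.Adj b e
  ne_ac : a ≠ c
  ne_ae : a ≠ e
  ne_bc : b ≠ c
  ne_be : b ≠ e

theorem switch_adj {G : SimpleGraph V} {a b c e x y : V} (h : Switchable G a b c e) :
    (switch G a b c e).Adj x y ↔
      (G.Adj x y ∧ ¬ (x = a ∧ y = b ∨ x = b ∧ y = a) ∧ ¬ (x = c ∧ y = e ∨ x = e ∧ y = c)) ∨
        (x = a ∧ y = c ∨ x = c ∧ y = a) ∨ (x = b ∧ y = e ∨ x = e ∧ y = b) := by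
  have h1 := h.ne_ac
  have h2 := h.ne_be
  simp only [switch, sup_adj, deleteEdges_adj, fromEdgeSet_adj, Set.mem_insert_iff,
    Set.mem_singleton_iff, Sym2.eq_iff, not_or]
  grind

theorem Switchable.symm {G : SimpleGraph V} {a b c e : V} (h : Switchable G a b c e) :
    Switchable (switch G a b c e) a c b e := by
  have hab := h.adj_ab.ne
  have hce := h.adj_ce.ne
  have hadj (x y : V) := switch_adj (x := x) (y := y) h
  obtain ⟨_, _, _, _, _, _, _, _⟩ := h
  refine ⟨?_, ?_, ?_, ?_, ?_, ?_, ?_, ?_⟩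
  · rw [hadj]; simp
  · rw [hadj]; simp
  · rw [hadj]; clear hadj; grind
  · rw [hadj]; clear hadj; grind
  all_goals first | assumption | exact Ne.symm ‹_›

/-- The inverse of a switching is the switching with `b` and `c` exchanged; this gives injectivity
in the double count. -/
theorem switch_switch {G : SimpleGraph V} {a b c e : V} (h : Switchable G a b c e) :
    switch (switch G a b c e) a c b e = G := by
  ext x y
  have hab := h.adj_ab.ne
  have hce := h.adj_ce.ne
  rw [switch_adj h.symm, switch_adj h]
  obtain ⟨h1, h2, h3, h4, _, _, _, _⟩ := h
  have h1' := h1.symm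
  have h2' := h2.symm
  have h3' : ¬ G.Adj c a := fun h => h3 h.symm
  have h4' : ¬ G.Adj e b := fun h => h4 h.symm
  constructor
  · grind
  · intro h
    by_cases h5 : x = a ∧ y = b ∨ x = b ∧ y = a
    · exact .inr (.inl h5)
    by_cases h6 : x = c ∧ y = e ∨ x = e ∧ y = c
    · exact .inr (.inr h6)
    refine .inl ⟨.inl ⟨h, h5, h6⟩, ?_, ?_⟩ <;> grind

/-- Every excluded edge or coincidence would join `a` to `c` by a walk of length at most 3, the
longest being `a, b, e, c`. -/
theorem switchable_of_far {G : SimpleGraph V} {a b c e : V} (hab : G.Adj a b) (hce : G.Adj c e)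
    {L : ℕ} (hac : ¬ G.edist a c ≤ (L + 3 : ℕ)) : Switchable G a b c e := by
  have hcomm : ¬ G.edist a c ≤ (3 : ℕ) := fun h => hac (h.trans (by gcongr; omega))
  have one (x y : V) (h : G.Adj x y) : G.edist x y ≤ (1 : ℕ) := by
    simpa using (edist_eq_one_iff_adj.mpr h).le
  have zero (x : V) : G.edist x x ≤ (0 : ℕ) := by simp
  have le3 (x : V) (k : ℕ) (hk : k ≤ 3) (h : G.edist a x ≤ k) : G.edist a x ≤ (3 : ℕ) :=
    h.trans (by gcongr)
  refine ⟨hab, hce, fun h => ?_, fun h => ?_, ?_, ?_, ?_, ?_⟩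
  · exact hcomm (le3 _ 1 (by omega) (one _ _ h))
  · exact hcomm (edist_le_succ_of_adj (edist_le_succ_of_adj (one _ _ hab) h) hce.symm)
  · rintro rfl
    exact hcomm (le3 _ 0 (by omega) (zero _))
  · rintro rfl
    exact hcomm (le3 _ 1 (by omega) (one _ _ hce.symm))
  · rintro rfl
    exact hcomm (le3 _ 1 (by omega) (one _ _ hab))
  · rintro rfl
    exact hcomm (le3 _ 2 (by omega) (edist_le_succ_of_adj (one _ _ hab) hce.symm))

/-- A short path from `a` to `b` avoiding the edge `ab` stays within `L` of `a`, so it misses `c`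
and hence the other deleted edge `ce`. After the switching, `b` thus remains in a bounded ball
around `a`, which limits the possible images. -/
theorem edist_switch_le {G : SimpleGraph V} {a b c e : V} {L : ℕ}
    (hL : (G.deleteEdges {s(a, b)}).edist a b ≤ L) (hc : ¬ G.edist a c ≤ L) :
    (switch G a b c e).edist a b ≤ L := by
  classical
  obtain ⟨p, hp⟩ := exists_walk_of_edist_ne_top (ne_top_of_le_ne_top (ENat.natCast_ne_top _) hL)
  rw [← hp] at hL
  have hpc : c ∉ p.support := by
    intro h
    refine hc ((edist_anti (deleteEdges_le _)).trans ((edist_le (p.takeUntil c h)).trans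
      (le_trans ?_ hL)))
    exact_mod_cast p.length_takeUntil_le_length h
  have hedge : ∀ s ∈ p.edges, s ∈ (switch G a b c e).edgeSet := by
    intro s hs
    have h1 := p.edges_subset_edgeSet hs
    induction s with | _ x y =>
    have hx : x ≠ c := fun h => hpc (h ▸ p.fst_mem_support_of_mem_edges hs)
    have hy : y ≠ c := fun h => hpc (h ▸ p.snd_mem_support_of_mem_edges hs)
    rw [mem_edgeSet, deleteEdges_adj] at h1
    rw [mem_edgeSet, switch, sup_adj, deleteEdges_adj]
    refine .inl ⟨h1.1, ?_⟩
    simp only [Set.mem_insert_iff, Set.mem_singleton_iff, not_or] at h1 ⊢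
    refine ⟨h1.2, ?_⟩
    rw [Sym2.eq_iff]
    grind
  refine (edist_le (p.transfer _ hedge)).trans ?_
  rwa [Walk.length_transfer]

variable [Fintype V]

open Classical in
theorem card_filter_edist_le {G : SimpleGraph V} {d : ℕ} (hG : G.IsRegularOfDegree d) (u : V)
    (k : ℕ) : (Finset.univ.filter fun v => G.edist u v ≤ k).card ≤ (d + 1) ^ k := by
  induction k with
  | zero =>
    have : (Finset.univ.filter fun v => G.edist u v ≤ (0 : ℕ)) = {u} := by
      ext v
      simp only [Finset.mem_filter, Finset.mem_univ, true_and, Finset.mem_singleton,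
        Nat.cast_zero, nonpos_iff_eq_zero, edist_eq_zero_iff]
      exact eq_comm
    rw [this]; simp
  | succ k ih =>
    have hsub : (Finset.univ.filter fun v => G.edist u v ≤ (k + 1 : ℕ)) ⊆
        (Finset.univ.filter fun v => G.edist u v ≤ k).biUnion
          fun w => insert w (G.neighborFinset w) := by
      intro v hv
      simp only [Finset.mem_filter, Finset.mem_univ, true_and] at hv
      simp only [Finset.mem_biUnion, Finset.mem_filter, Finset.mem_univ, true_and,
        Finset.mem_insert, mem_neighborFinset]
      by_cases huv : u = v
      · exact ⟨u, by simp, .inl huv.symm⟩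
      · obtain ⟨w, hw, hwv⟩ := exists_adj_edist_le_of_edist_le_succ huv hv
        exact ⟨w, hw, .inr hwv⟩
    refine (Finset.card_le_card hsub).trans ((Finset.card_biUnion_le_card_mul _ _ (d + 1) ?_).trans
      (by rw [pow_succ]; gcongr))
    intro w _
    refine (Finset.card_insert_le _ _).trans ?_
    rw [card_neighborFinset_eq_degree, hG.degree_eq]

-- Each of `a`, `b`, `c`, `e` loses one neighbour and gains one non-neighbour; other neighbourhoods
-- do not change.
open Classical in
theorem switch_isRegularOfDegree {G : SimpleGraph V} {a b c e : V} (h : Switchable G a b c e)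
    {d : ℕ} (hG : G.IsRegularOfDegree d) : (switch G a b c e).IsRegularOfDegree d := by
  have hab := h.adj_ab.ne
  have hce := h.adj_ce.ne
  have key (x y z : V) (hy : G.Adj x y) (hz : ¬ G.Adj x z)
      (hx : ∀ v, (switch G a b c e).Adj x v ↔ v = z ∨ (v ≠ y ∧ G.Adj x v)) :
      (switch G a b c e).degree x = d := by
    have : (switch G a b c e).neighborFinset x = insert z ((G.neighborFinset x).erase y) := by
      ext v
      simp [hx v]
    rw [← card_neighborFinset_eq_degree, this, Finset.card_insert_of_notMem (by simp [hz]),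
      Finset.card_erase_add_one (by simpa using hy), card_neighborFinset_eq_degree, hG.degree_eq]
  intro x
  have hadj (v : V) := switch_adj (x := x) (y := v) h
  obtain ⟨h1, h2, h3, h4, _, _, _, _⟩ := h
  have h3' : ¬ G.Adj c a := fun h => h3 h.symm
  have h4' : ¬ G.Adj e b := fun h => h4 h.symm
  by_cases hxa : x = a
  · subst hxa
    exact key x b c h1 h3 fun v => by rw [hadj]; clear key hadj; grind
  by_cases hxb : x = b
  · subst hxb
    exact key x a e h1.symm h4 fun v => by rw [hadj]; clear key hadj; grind
  by_cases hxc : x = c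
  · subst hxc
    exact key x e a h2 h3' fun v => by rw [hadj]; clear key hadj; grind
  by_cases hxe : x = e
  · subst hxe
    exact key x c b h2.symm h4' fun v => by rw [hadj]; clear key hadj; grind
  · have : (switch G a b c e).neighborFinset x = G.neighborFinset x := by
      ext v
      simp [hadj, hxa, hxb, hxc, hxe]
    rw [← card_neighborFinset_eq_degree, this, card_neighborFinset_eq_degree, hG.degree_eq]

open Classical in
/-- The `d`-regular graphs on `V`. -/
noncomputable def regularGraphs (V : Type*) [Fintype V] (d : ℕ) : Finset (SimpleGraph V) :=
  Finset.univ.filter fun G => G.IsRegularOfDegree d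

open Classical in
theorem mem_regularGraphs {d : ℕ} {G : SimpleGraph V} :
    G ∈ regularGraphs V d ↔ G.IsRegularOfDegree d := by
  simp [regularGraphs]

/-- The pairs of a `d`-regular graph and a directed edge of it that lies on a cycle of length at
most `L + 1`. -/
noncomputable def shortCycleEdges (V : Type*) [Fintype V] (d L : ℕ) :
    Finset ((SimpleGraph V × V) × V) :=
  pairs (pairs (regularGraphs V d) fun _ (_ : V) => True) fun x b => IsShortCycleEdge x.1 L x.2 b

theorem mem_shortCycleEdges {d L : ℕ} {x : (SimpleGraph V × V) × V} :
    x ∈ shortCycleEdges V d L ↔ x.1.1 ∈ regularGraphs V d ∧ IsShortCycleEdge x.1.1 L x.1.2 x.2 := by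
  simp [shortCycleEdges, mem_pairs]

open Classical in
/-- Edges on short cycles are rare in a random regular graph: the bound on the number of pairs of
a regular graph and such an edge, from the switchings of this edge with a remote one. -/
theorem card_isShortCycleEdge_mul_le (V : Type*) [Fintype V] (d L : ℕ) :
    (shortCycleEdges V d L).card *
        (Fintype.card V - (d + 1) ^ (L + 3)) ≤
      (regularGraphs V d).card *
        (Fintype.card V * (d + 1) ^ L * d * d) := by
  -- The switching needs a neighbour `e` of the remote vertex `c`, which exists only for `d > 0`.
  rcases Nat.eq_zero_or_pos d with rfl | hd
  · have : shortCycleEdges V 0 L = ∅ := by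
      rw [Finset.eq_empty_iff_forall_notMem]
      rintro ⟨⟨G, a⟩, b⟩ h
      obtain ⟨hG, hab, _⟩ := mem_shortCycleEdges.mp h
      have : b ∈ G.neighborFinset a := by simpa using hab
      rw [Finset.card_eq_zero.mp ((G.card_neighborFinset_eq_degree a).trans
        ((mem_regularGraphs.mp hG).degree_eq a))] at this
      simp at this
    rw [this]; simp
  -- `T₄` holds the possible images `(G', a, b, c, e)`: `b` is within `L` of `a` and `ac`, `be` are
  -- edges of `G'`. `S'` holds the sources, short-cycle edges `ab` with a remote `c`.
  let R := regularGraphs V d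
  let T₁ : Finset (SimpleGraph V × V) := pairs R fun _ _ => True
  let T₂ : Finset ((SimpleGraph V × V) × V) := pairs T₁ fun x b => x.1.edist x.2 b ≤ L
  let T₃ : Finset (((SimpleGraph V × V) × V) × V) := pairs T₂ fun x c => x.1.1.Adj x.1.2 c
  let T₄ : Finset ((((SimpleGraph V × V) × V) × V) × V) :=
    pairs T₃ fun x e => x.1.1.1.Adj x.1.2 e
  let S' : Finset (((SimpleGraph V × V) × V) × V) :=
    pairs (shortCycleEdges V d L) fun x c => ¬ x.1.1.edist x.1.2 c ≤ (L + 3 : ℕ)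
  have hdeg (G : SimpleGraph V) (hG : G.IsRegularOfDegree d) (v : V) :
      (Finset.univ.filter fun w => G.Adj v w).card = d := by
    rw [← hG.degree_eq v, ← card_neighborFinset_eq_degree, neighborFinset_eq_filter]
  have hT₁ : T₁.card ≤ R.card * Fintype.card V :=
    card_pairs_le _ _ fun _ _ => Finset.card_le_univ _
  have hT₂ : T₂.card ≤ T₁.card * (d + 1) ^ L :=
    card_pairs_le _ _ fun x hx => by
      convert card_filter_edist_le (mem_regularGraphs.mp (mem_pairs.mp hx).1) x.2 L
  have hT₃ : T₃.card ≤ T₂.card * d :=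
    card_pairs_le _ _ fun x hx =>
      (hdeg _ (mem_regularGraphs.mp (mem_pairs.mp (mem_pairs.mp hx).1).1) _).le
  have hT₄ : T₄.card ≤ T₃.card * d :=
    card_pairs_le _ _ fun x hx =>
      (hdeg _ (mem_regularGraphs.mp (mem_pairs.mp (mem_pairs.mp (mem_pairs.mp hx).1).1).1) _).le
  have hS : (shortCycleEdges V d L).card * (Fintype.card V - (d + 1) ^ (L + 3)) ≤ S'.card := by
    refine le_card_pairs _ _ fun x hx => ?_
    have h1 := card_filter_edist_le (mem_regularGraphs.mp (mem_shortCycleEdges.mp hx).1) x.1.2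
      (L + 3)
    have h2 := Finset.card_filter_add_card_filter_not (s := Finset.univ)
      (fun c => x.1.1.edist x.1.2 c ≤ (L + 3 : ℕ))
    rw [Finset.card_univ] at h2
    have h3 : Fintype.card V - (d + 1) ^ (L + 3) ≤
        (Finset.univ.filter fun c => ¬ x.1.1.edist x.1.2 c ≤ (L + 3 : ℕ)).card := by omega
    convert h3
  -- One fixed neighbour `e` of `c` is chosen per graph, so each source has a single switching.
  have hnbr (G : SimpleGraph V) (c : V) : ∃ e, G.IsRegularOfDegree d → G.Adj c e := by
    by_cases hG : G.IsRegularOfDegree d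
    · have : (G.neighborFinset c).Nonempty := by
        rw [← Finset.card_pos, card_neighborFinset_eq_degree, hG.degree_eq]; exact hd
      obtain ⟨e, he⟩ := this
      exact ⟨e, fun _ => by simpa using he⟩
    · exact ⟨c, fun h => absurd h hG⟩
  choose nbr hnbr using hnbr
  have hmem {G : SimpleGraph V} {a b c : V} (hx : (((G, a), b), c) ∈ S') :
      G.IsRegularOfDegree d ∧ (G.deleteEdges {s(a, b)}).edist a b ≤ L ∧
        ¬ G.edist a c ≤ (L + 3 : ℕ) ∧ Switchable G a b c (nbr G c) := by
    obtain ⟨h, hfar⟩ := mem_pairs.mp hx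
    obtain ⟨hG, hab, hL⟩ := mem_shortCycleEdges.mp h
    have hG := mem_regularGraphs.mp hG
    exact ⟨hG, hL, hfar, switchable_of_far hab (hnbr G c hG) hfar⟩
  have hST : S'.card ≤ T₄.card := by
    refine Finset.card_le_card_of_injOn (fun x =>
      ((((switch x.1.1.1 x.1.1.2 x.1.2 x.2 (nbr x.1.1.1 x.2), x.1.1.2), x.1.2), x.2),
        nbr x.1.1.1 x.2)) ?_ ?_
    · rintro ⟨⟨⟨G, a⟩, b⟩, c⟩ hx
      obtain ⟨hG, hL, hfar, hsw⟩ := hmem hx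
      refine mem_pairs.mpr ⟨mem_pairs.mpr ⟨mem_pairs.mpr ⟨mem_pairs.mpr
        ⟨mem_regularGraphs.mpr (switch_isRegularOfDegree hsw hG), trivial⟩, ?_⟩, ?_⟩, ?_⟩
      · exact edist_switch_le hL (fun h => hfar (h.trans (by gcongr; omega)))
      · exact (switch_adj hsw).mpr (by simp)
      · exact (switch_adj hsw).mpr (by simp)
    · rintro ⟨⟨⟨G, a⟩, b⟩, c⟩ hx ⟨⟨⟨G', a'⟩, b'⟩, c'⟩ hx' heq
      simp only [Prod.mk.injEq] at heq
      obtain ⟨⟨⟨⟨h1, rfl⟩, rfl⟩, rfl⟩, he⟩ := heq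
      have := switch_switch (hmem hx).2.2.2
      rw [h1, he, switch_switch (hmem hx').2.2.2] at this
      rw [this]
  calc _ ≤ T₄.card := hS.trans hST
    _ ≤ R.card * Fintype.card V * (d + 1) ^ L * d * d :=
      hT₄.trans (Nat.mul_le_mul_right _ (hT₃.trans (Nat.mul_le_mul_right _
        (hT₂.trans (Nat.mul_le_mul_right _ hT₁)))))
    _ = _ := by ring

/-- The pairs of a regular graph and a vertex within distance `r` of a cycle of length at most
`L + 1`. -/
noncomputable def nearShortCycle (V : Type*) [Fintype V] (d L r : ℕ) : Finset (SimpleGraph V × V) :=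
  pairs (regularGraphs V d) fun G u => ∃ a b, G.edist u a ≤ r ∧ IsShortCycleEdge G L a b

/-- Each short-cycle edge `ab` spoils only the vertices in the `r`-ball around `a`. -/
theorem card_nearShortCycle_mul_le (V : Type*) [Fintype V] (d L r : ℕ) :
    (nearShortCycle V d L r).card * (Fintype.card V - (d + 1) ^ (L + 3)) ≤
      (regularGraphs V d).card * (Fintype.card V * (d + 1) ^ L * d * d * (d + 1) ^ r) := by
  classical
  let S := pairs (shortCycleEdges V d L) fun x u => x.1.1.edist x.1.2 u ≤ r
  have h1 : S.card ≤ (shortCycleEdges V d L).card * (d + 1) ^ r :=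
    card_pairs_le _ _ fun x hx => by
      convert card_filter_edist_le (mem_regularGraphs.mp (mem_shortCycleEdges.mp hx).1) x.1.2 r
  have h2 : nearShortCycle V d L r ⊆ S.image fun x => (x.1.1.1, x.2) := by
    rintro ⟨G, u⟩ hx
    obtain ⟨hG, a, b, hua, hab⟩ := mem_pairs.mp hx
    refine Finset.mem_image.mpr ⟨(((G, a), b), u), ?_, rfl⟩
    exact mem_pairs.mpr ⟨mem_shortCycleEdges.mpr ⟨hG, hab⟩, by rwa [edist_comm]⟩
  calc _ ≤ (shortCycleEdges V d L).card * (d + 1) ^ r * (Fintype.card V - (d + 1) ^ (L + 3)) :=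
        Nat.mul_le_mul_right _ ((Finset.card_le_card h2).trans (Finset.card_image_le.trans h1))
    _ = (shortCycleEdges V d L).card * (Fintype.card V - (d + 1) ^ (L + 3)) * (d + 1) ^ r := by
        ring
    _ ≤ _ := Nat.mul_le_mul_right _ (card_isShortCycleEdge_mul_le V d L)
    _ = _ := by ring

end Graph
-- Breadth-first numbering of the regular tree
section TreeArithmetic

theorem treeParent_of_le {d w : ℕ} (h : w ≤ d) : treeParent d w = 0 := if_pos h

theorem treeParent_of_lt {d w : ℕ} (h : d < w) : treeParent d w = 1 + (w - 1 - d) / (d - 1) :=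
  if_neg (not_le.mpr h)

theorem treeParent_lt {d w : ℕ} (hd : 0 < d) (hw : 0 < w) : treeParent d w < w := by
  rcases le_or_gt w d with h | h
  · rwa [treeParent_of_le h]
  · rw [treeParent_of_lt h]
    have := Nat.div_le_self (w - 1 - d) (d - 1)
    omega

/-- The position of the vertex `w ≥ 1` among the children of its parent. -/
def childIndex (d w : ℕ) : ℕ := if w ≤ d then w - 1 else (w - 1 - d) % (d - 1)

/-- The number of children of the vertex `p` in the infinite tree. -/
def numChildren (d p : ℕ) : ℕ := if p = 0 then d else d - 1

/-- The child with index `j` of the vertex `p`. -/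
def child (d p j : ℕ) : ℕ := if p = 0 then j + 1 else d + (p - 1) * (d - 1) + 1 + j

theorem treeSize_zero (d : ℕ) : treeSize d 0 = 1 := by simp [treeSize]

/-- Counts the root, its `d` children, and `d - 1` children for each non-root vertex of the tree of
depth `r`; this form matches the breadth-first numbering. -/
theorem treeSize_succ (d r : ℕ) :
    treeSize d (r + 1) = 1 + d + (d - 1) * (treeSize d r - 1) := by
  have : treeSize d r - 1 = d * ∑ i ∈ Finset.range r, (d - 1) ^ i := by simp [treeSize]
  rw [this, treeSize, Finset.sum_range_succ', mul_add, pow_zero, mul_one,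
    Finset.mul_sum, Finset.mul_sum, Finset.mul_sum]
  have : ∑ i ∈ Finset.range r, d * (d - 1) ^ (i + 1) =
      ∑ i ∈ Finset.range r, (d - 1) * (d * (d - 1) ^ i) :=
    Finset.sum_congr rfl fun i _ => by ring
  omega

theorem treeSize_mono (d : ℕ) : Monotone (treeSize d) := by
  intro r s h
  unfold treeSize
  gcongr

/-- For `d = 1` the tree has no vertex numbered beyond `1`; hence divisions by `d - 1` are never by
zero on actual vertices. -/
theorem two_le_of_mem_tree {d w k : ℕ} (hd : 0 < d) (hw : d < w) (hk : w < treeSize d (k + 1)) :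
    2 ≤ d := by
  by_contra h
  obtain rfl : d = 1 := by omega
  rw [treeSize_succ] at hk
  omega

theorem treeParent_lt_treeSize {d w k : ℕ} (hd : 0 < d)
    (hk : w < treeSize d (k + 1)) : treeParent d w < treeSize d k := by
  rcases le_or_gt w d with h | h
  · rw [treeParent_of_le h]; exact treeSize_pos d k
  · have h2 := two_le_of_mem_tree hd h hk
    rw [treeParent_of_lt h]
    rw [treeSize_succ d k] at hk
    have : (w - 1 - d) / (d - 1) < treeSize d k - 1 := by
      rw [Nat.div_lt_iff_lt_mul (by omega), mul_comm]
      omega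
    generalize (w - 1 - d) / (d - 1) = q at this ⊢
    omega

theorem childIndex_lt {d w k : ℕ} (hd : 0 < d) (hw : 0 < w) (hk : w < treeSize d (k + 1)) :
    childIndex d w < numChildren d (treeParent d w) := by
  rcases le_or_gt w d with h | h
  · rw [treeParent_of_le h, childIndex, if_pos h, numChildren, if_pos rfl]; omega
  · have h2 := two_le_of_mem_tree hd h hk
    rw [treeParent_of_lt h, childIndex, if_neg (by omega), numChildren, if_neg (by simp)]
    exact Nat.mod_lt _ (by omega)

/-- Past the first level, parent and index are the quotient and remainder of `w - 1 - d` by `d - 1`.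
-/
theorem child_treeParent_childIndex {d w : ℕ} (hw : 0 < w) :
    child d (treeParent d w) (childIndex d w) = w := by
  rcases le_or_gt w d with h | h
  · rw [treeParent_of_le h, childIndex, if_pos h, child, if_pos rfl]; omega
  · rw [treeParent_of_lt h, childIndex, if_neg (by omega), child, if_neg (by simp)]
    have := Nat.div_add_mod' (w - 1 - d) (d - 1)
    rw [Nat.add_sub_cancel_left]
    omega

theorem child_pos (d p j : ℕ) : 0 < child d p j := by
  unfold child; split_ifs <;> omega

theorem treeParent_child {d p j : ℕ} (h : j < numChildren d p) :
    treeParent d (child d p j) = p := by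
  unfold numChildren at h
  unfold child
  split_ifs at h ⊢ with hp
  · rw [treeParent_of_le (by omega), hp]
  · rw [treeParent_of_lt (by omega)]
    have : d + (p - 1) * (d - 1) + 1 + j - 1 - d = j + (p - 1) * (d - 1) := by omega
    rw [this, Nat.add_mul_div_right _ _ (by omega), Nat.div_eq_of_lt h]
    omega

theorem childIndex_child {d p j : ℕ} (h : j < numChildren d p) :
    childIndex d (child d p j) = j := by
  unfold numChildren at h
  unfold child
  split_ifs at h ⊢ with hp
  · rw [childIndex, if_pos (by omega)]; omega
  · rw [childIndex, if_neg (by omega)]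
    have : d + (p - 1) * (d - 1) + 1 + j - 1 - d = j + (p - 1) * (d - 1) := by omega
    rw [this, Nat.add_mul_mod_self_right, Nat.mod_eq_of_lt h]

theorem child_lt_treeSize {d p j k : ℕ} (h : j < numChildren d p)
    (hp : p < treeSize d k) : child d p j < treeSize d (k + 1) := by
  rw [treeSize_succ d k]
  unfold numChildren at h
  unfold child
  split_ifs at h ⊢ with hp0
  · omega
  · have : p * (d - 1) ≤ (d - 1) * (treeSize d k - 1) := by
      rw [mul_comm]; exact Nat.mul_le_mul_left _ (by omega)
    have h' : p * (d - 1) = (p - 1) * (d - 1) + (d - 1) := by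
      obtain ⟨q, rfl⟩ : ∃ q, p = q + 1 := ⟨p - 1, by omega⟩
      rw [Nat.add_sub_cancel]; ring
    omega

end TreeArithmetic

/-! ### Tree-like balls are regular trees -/

section Cover

open SimpleGraph

variable {V : Type*}

/-- A shortest path from `u` to `y` cannot pass through `x`, for then `x` would be strictly closer;
so it survives deleting any edge at `x`. -/
theorem edist_deleteEdges_le {G : SimpleGraph V} {u x y : V} {r : ℕ} (hxy : x ≠ y)
    (h : G.edist u y ≤ G.edist u x) (hx : G.edist u x ≤ r) (z : V) :
    (G.deleteEdges {s(x, z)}).edist u y ≤ r := by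
  classical
  have hr : G.edist u y ≤ r := h.trans hx
  obtain ⟨p, hp⟩ := exists_walk_of_edist_ne_top (ne_top_of_le_ne_top (ENat.natCast_ne_top _) hr)
  have hpx : x ∉ p.support := by
    intro hmem
    have h1 := p.length_takeUntil_lt_length hmem hxy
    have h2 := (edist_le (p.takeUntil x hmem)).trans_lt (Nat.cast_lt.mpr h1)
    rw [hp] at h2
    exact absurd h (not_le.mpr h2)
  have hedge : ∀ s ∈ p.edges, s ∈ (G.deleteEdges {s(x, z)}).edgeSet := by
    intro s hs
    rw [edgeSet_deleteEdges]
    refine ⟨p.edges_subset_edgeSet hs, ?_⟩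
    rintro rfl
    exact hpx (p.fst_mem_support_of_mem_edges hs)
  refine (edist_le (p.transfer _ hedge)).trans ?_
  rwa [Walk.length_transfer, hp]

/-- The edges at the vertices within distance `r` of `u` lie on no cycle of length at most
`2 * r + 2`. -/
def TreeLike (G : SimpleGraph V) (u : V) (r : ℕ) : Prop :=
  ∀ a b, G.edist u a ≤ r → ¬ IsShortCycleEdge G (2 * r + 1) a b

/-- Each vertex of the ball has at most one neighbour that is no farther from `u`. With two, the
walk `x, z, …, u, …, y` has length at most `1 + r + r` and avoids `xy`, closing a forbidden cycle.
-/
theorem TreeLike.eq_of_adj {G : SimpleGraph V} {u : V} {r : ℕ} (hu : TreeLike G u r) {x y z : V}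
    (hx : G.edist u x ≤ r) (hxy : G.Adj x y) (hxz : G.Adj x z)
    (hy : G.edist u y ≤ G.edist u x) (hz : G.edist u z ≤ G.edist u x) : y = z := by
  by_contra hyz
  refine hu x y hx ⟨hxy, ?_⟩
  have h1 := edist_deleteEdges_le hxy.ne hy hx y
  have h2 := edist_deleteEdges_le hxz.ne hz hx y
  have h3 : (G.deleteEdges {s(x, y)}).edist x z = 1 := by
    rw [edist_eq_one_iff_adj, deleteEdges_adj]
    refine ⟨hxz, ?_⟩
    rw [Set.mem_singleton_iff, Sym2.eq_iff]
    have := hxy.ne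
    grind
  rw [edist_comm] at h2
  have h4 := (SimpleGraph.edist_triangle (G := G.deleteEdges {s(x, y)}) (u := x) (v := z)
    (w := y)).trans (add_le_add h3.le
      ((SimpleGraph.edist_triangle (v := u)).trans (add_le_add h2 h1)))
  refine h4.trans_eq ?_
  push_cast
  ring

/-- The unfolding of a graph from the vertex `u` by the infinite regular tree: the image of a
vertex of the tree together with the image of its parent. Here `nb v p` enumerates the neighbours
of `v` other than `p`. -/
def cover (nb : V → V → ℕ → V) (u : V) (d w : ℕ) : V × V :=
  if h : 0 < d ∧ 0 < w then
    have := treeParent_lt h.1 h.2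
    let p := cover nb u d (treeParent d w)
    (nb p.1 p.2 (childIndex d w), p.1)
  -- The root is its own dummy parent. As `u` is not its own neighbour, `nb u u` lists all `d`
  -- neighbours.
  else (u, u)
termination_by w

theorem cover_zero (nb : V → V → ℕ → V) (u : V) (d : ℕ) : cover nb u d 0 = (u, u) := by
  rw [cover]; simp

theorem cover_of_pos (nb : V → V → ℕ → V) (u : V) {d w : ℕ} (hd : 0 < d) (hw : 0 < w) :
    cover nb u d w = (nb (cover nb u d (treeParent d w)).1 (cover nb u d (treeParent d w)).2
      (childIndex d w), (cover nb u d (treeParent d w)).1) := by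
  rw [cover]; simp [hd, hw]

theorem exists_bijOn_Iio {α : Type*} [Nonempty α] (s : Finset α) :
    ∃ f : ℕ → α, Set.BijOn f (Set.Iio s.card) s := by
  classical
  let e := s.equivFin.symm
  refine ⟨fun i => if h : i < s.card then e ⟨i, h⟩ else Classical.arbitrary α, ?_, ?_, ?_⟩
  · intro i hi
    simp only [Set.mem_Iio] at hi
    simp [hi]
  · intro i hi j hj hij
    simp only [Set.mem_Iio] at hi hj
    simpa [hi, hj, Subtype.ext_iff.symm] using hij
  · intro x hx
    refine ⟨e.symm ⟨x, hx⟩, (e.symm ⟨x, hx⟩).2, ?_⟩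
    simp

/-- The enumerations `nb` list neighbours as required by `cover`. -/
def IsEnum (G : SimpleGraph V) (d : ℕ) (nb : V → V → ℕ → V) : Prop :=
  (∀ v, Set.BijOn (nb v v) (Set.Iio d) {y | G.Adj v y}) ∧
    ∀ v p, G.Adj v p → Set.BijOn (nb v p) (Set.Iio (d - 1)) {y | G.Adj v y ∧ y ≠ p}

open Classical in
theorem exists_isEnum [Fintype V] {G : SimpleGraph V} {d : ℕ} (hG : G.IsRegularOfDegree d) :
    ∃ nb, IsEnum G d nb := by
  have h (v p : V) : ∃ f : ℕ → V, Set.BijOn f (Set.Iio ((G.neighborFinset v).erase p).card)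
      ((G.neighborFinset v).erase p : Finset V) :=
    have : Nonempty V := ⟨v⟩
    exists_bijOn_Iio _
  choose nb hnb using h
  refine ⟨nb, fun v => ?_, fun v p hvp => ?_⟩
  · have := hnb v v
    rw [Finset.erase_eq_of_notMem (by simp), card_neighborFinset_eq_degree, hG.degree_eq] at this
    convert this
    ext y; simp
  · have := hnb v p
    rw [Finset.card_erase_of_mem (by simpa using hvp), card_neighborFinset_eq_degree,
      hG.degree_eq] at this
    convert this
    ext y; simp [and_comm]

variable {G : SimpleGraph V} {u : V} {d r : ℕ} {nb : V → V → ℕ → V}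

/-- The image of the parent is the only neighbour no farther from `u`, and the enumeration skips it;
so each step down the tree raises the distance by exactly one. -/
theorem cover_spec (hd : 0 < d) (hnb : IsEnum G d nb) (hu : TreeLike G u r) {k : ℕ} (hk : k ≤ r)
    {w : ℕ} (hw : w < treeSize d k) :
    G.edist u (cover nb u d w).1 ≤ k ∧
      (0 < w → G.Adj (cover nb u d w).2 (cover nb u d w).1 ∧
        G.edist u (cover nb u d w).1 = G.edist u (cover nb u d w).2 + 1) := by
  induction k generalizing w with
  | zero =>
    rw [treeSize_zero] at hw
    obtain rfl : w = 0 := by omega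
    simp [cover_zero]
  | succ k ih =>
    rcases Nat.eq_zero_or_pos w with rfl | hw0
    · simp [cover_zero]
    have hp := ih (by omega) (treeParent_lt_treeSize hd hw)
    have hidx := childIndex_lt hd hw0 hw
    have hk' : ((k : ℕ) : ℕ∞) ≤ r := by exact_mod_cast (by omega : k ≤ r)
    have hcov := cover_of_pos nb u hd hw0
    set p := treeParent d w
    have hne : G.edist u (cover nb u d p).1 ≠ ⊤ :=
      ne_top_of_le_ne_top (ENat.natCast_ne_top _) hp.1
    have key : G.Adj (cover nb u d p).1 (cover nb u d w).1 ∧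
        ¬ G.edist u (cover nb u d w).1 ≤ G.edist u (cover nb u d p).1 := by
      rw [hcov]
      dsimp only
      rcases Nat.eq_zero_or_pos p with hp0 | hp0
      · rw [hp0, cover_zero]
        rw [hp0, numChildren, if_pos rfl] at hidx
        have hadj : G.Adj u (nb u u (childIndex d w)) := (hnb.1 u).mapsTo hidx
        refine ⟨hadj, fun h => hadj.ne ?_⟩
        rw [edist_self] at h
        exact edist_eq_zero_iff.mp (nonpos_iff_eq_zero.mp h)
      · rw [numChildren, if_neg (by omega)] at hidx
        obtain ⟨h1, h2⟩ := hp.2 hp0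
        obtain ⟨h3, h4⟩ := (hnb.2 _ _ h1.symm).mapsTo hidx
        refine ⟨h3, fun h => h4 ?_⟩
        exact hu.eq_of_adj (hp.1.trans hk') h3 h1.symm h (by rw [h2]; exact le_self_add)
    have h2 : (cover nb u d w).2 = (cover nb u d p).1 := by rw [hcov]
    have hle : G.edist u (cover nb u d w).1 ≤ G.edist u (cover nb u d p).1 + 1 :=
      G.edist_triangle.trans (add_le_add le_rfl (edist_eq_one_iff_adj.mpr key.1).le)
    refine ⟨hle.trans (by push_cast; gcongr; exact hp.1), fun _ => ?_⟩
    rw [h2]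
    refine ⟨key.1, hle.antisymm ?_⟩
    exact Order.add_one_le_of_lt (not_le.mp key.2)

theorem cover_snd (hd : 0 < d) {w : ℕ} (hw : 0 < w) :
    (cover nb u d w).2 = (cover nb u d (treeParent d w)).1 := by
  rw [cover_of_pos nb u hd hw]

theorem cover_snd_le (hd : 0 < d) (hnb : IsEnum G d nb) (hu : TreeLike G u r) {w : ℕ}
    (hw0 : 0 < w) (hw : w < treeSize d r) :
    G.Adj (cover nb u d w).1 (cover nb u d w).2 ∧
      G.edist u (cover nb u d w).2 ≤ G.edist u (cover nb u d w).1 := by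
  obtain ⟨h1, h2⟩ := (cover_spec hd hnb hu le_rfl hw).2 hw0
  exact ⟨h1.symm, by rw [h2]; exact le_self_add⟩

/-- If two images agree, so do their parents' images, by `TreeLike.eq_of_adj`; by induction the
parents agree, and injectivity of the enumeration gives equal child indices. -/
theorem cover_injOn (hd : 0 < d) (hnb : IsEnum G d nb) (hu : TreeLike G u r) {w w' : ℕ}
    (hw : w < treeSize d r) (hw' : w' < treeSize d r)
    (h : (cover nb u d w).1 = (cover nb u d w').1) : w = w' := by
  have hzero {w : ℕ} (hw : w < treeSize d r) (h : (cover nb u d w).1 = u) : w = 0 := by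
    by_contra h0
    have := ((cover_spec hd hnb hu le_rfl hw).2 (by omega)).2
    rw [h, edist_self] at this
    exact one_ne_zero (add_eq_zero.mp this.symm).2
  induction w using Nat.strong_induction_on generalizing w' with
  | _ w ih =>
  rcases Nat.eq_zero_or_pos w with rfl | hw0
  · rw [cover_zero] at h
    exact (hzero hw' h.symm).symm
  rcases Nat.eq_zero_or_pos w' with rfl | hw0'
  · rw [cover_zero] at h
    exact hzero hw h
  have hs := cover_spec hd hnb hu le_rfl hw
  have h1 := cover_snd_le hd hnb hu hw0 hw
  have h2 := cover_snd_le hd hnb hu hw0' hw'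
  rw [← h] at h2
  have h3 := hu.eq_of_adj hs.1 h1.1 h2.1 h1.2 h2.2
  rw [cover_snd hd hw0, cover_snd hd hw0'] at h3
  have hp := treeParent_lt hd hw0
  have hpar := ih _ hp (hp.trans hw) ((treeParent_lt hd hw0').trans hw') h3
  -- `childIndex_lt` is stated at a depth `k + 1`, while `r` may be `0`.
  have hr : treeSize d r ≤ treeSize d (r + 1) := treeSize_mono d (Nat.le_succ r)
  have hi := childIndex_lt hd hw0 (hw.trans_le hr)
  have hi' := childIndex_lt hd hw0' (hw'.trans_le hr)
  rw [cover_of_pos nb u hd hw0, cover_of_pos nb u hd hw0', ← hpar] at h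
  rw [← hpar] at hi'
  dsimp only at h
  have hidx : childIndex d w = childIndex d w' := by
    rcases Nat.eq_zero_or_pos (treeParent d w) with hp0 | hp0
    · rw [hp0, cover_zero] at h
      rw [hp0, numChildren, if_pos rfl] at hi hi'
      exact (hnb.1 u).injOn hi hi' h
    · rw [numChildren, if_neg (by omega)] at hi hi'
      exact (hnb.2 _ _ (cover_snd_le hd hnb hu hp0 (hp.trans hw)).1).injOn hi hi' h
  rw [← child_treeParent_childIndex (d := d) hw0, hpar, hidx, child_treeParent_childIndex hw0']

theorem exists_cover_eq (hd : 0 < d) (hnb : IsEnum G d nb) (hu : TreeLike G u r) {k : ℕ}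
    (hk : k ≤ r) {x : V} (hx : G.edist u x ≤ k) :
    ∃ w < treeSize d k, (cover nb u d w).1 = x := by
  induction k generalizing x with
  | zero =>
    refine ⟨0, treeSize_pos d 0, ?_⟩
    rw [cover_zero]
    rw [Nat.cast_zero, nonpos_iff_eq_zero, edist_eq_zero_iff] at hx
    exact hx
  | succ k ih =>
    by_cases hux : u = x
    · exact ⟨0, treeSize_pos d _, by rw [cover_zero, hux]⟩
    obtain ⟨y, hy, hyx⟩ := exists_adj_edist_le_of_edist_le_succ hux hx
    obtain ⟨p, hp, rfl⟩ := ih (by omega) hy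
    have hex : x = (cover nb u d p).2 ∧ 0 < p ∨
        ∃ j < numChildren d p, nb (cover nb u d p).1 (cover nb u d p).2 j = x := by
      rcases Nat.eq_zero_or_pos p with rfl | hp0
      · rw [cover_zero] at hyx ⊢
        exact .inr ((hnb.1 u).surjOn hyx)
      · by_cases hxp : x = (cover nb u d p).2
        · exact .inl ⟨hxp, hp0⟩
        · right
          rw [numChildren, if_neg (by omega)]
          have hadj := (cover_snd_le hd hnb hu hp0
            (hp.trans_le (treeSize_mono d (by omega)))).1
          exact (hnb.2 _ _ hadj).surjOn ⟨hyx, hxp⟩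
    rcases hex with ⟨hxp, hp0⟩ | ⟨j, hj, hjx⟩
    · refine ⟨treeParent d p, ?_, by rw [hxp, cover_snd hd hp0]⟩
      exact ((treeParent_lt hd hp0).trans hp).trans_le (treeSize_mono d (by omega))
    · refine ⟨child d p j, child_lt_treeSize hj hp, ?_⟩
      rw [cover_of_pos nb u hd (child_pos d p j), treeParent_child hj, childIndex_child hj, hjx]

/-- For an edge between images, the endpoint no farther from `u` must be the parent's image by
uniqueness. In particular no edge joins vertices at equal distance. -/
theorem cover_adj_iff (hd : 0 < d) (hnb : IsEnum G d nb) (hu : TreeLike G u r)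
    (w w' : Fin (treeSize d r)) :
    G.Adj (cover nb u d w).1 (cover nb u d w').1 ↔ (regularTree d r).Adj w w' := by
  have hback {w w' : Fin (treeSize d r)} (h0 : 0 < (w' : ℕ)) (h : (w : ℕ) = treeParent d w') :
      G.Adj (cover nb u d w).1 (cover nb u d w').1 := by
    have := (cover_snd_le hd hnb hu h0 w'.2).1.symm
    rwa [cover_snd hd h0, ← h] at this
  have hforth {w w' : Fin (treeSize d r)} (h : G.Adj (cover nb u d w).1 (cover nb u d w').1)
      (hle : G.edist u (cover nb u d w').1 ≤ G.edist u (cover nb u d w).1) :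
      0 < (w : ℕ) ∧ (w' : ℕ) = treeParent d w := by
    have h0 : 0 < (w : ℕ) := by
      by_contra h0
      have h0 : (w : ℕ) = 0 := by omega
      rw [h0, cover_zero] at hle h
      rw [edist_self] at hle
      exact h.ne (edist_eq_zero_iff.mp (nonpos_iff_eq_zero.mp hle))
    have h1 := cover_snd_le hd hnb hu h0 w.2
    have h2 := hu.eq_of_adj (cover_spec hd hnb hu le_rfl w.2).1 h h1.1 hle h1.2
    rw [cover_snd hd h0] at h2
    exact ⟨h0, cover_injOn hd hnb hu w'.2 ((treeParent_lt hd h0).trans w.2) h2⟩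
  rw [regularTree, fromRel_adj]
  constructor
  · intro h
    refine ⟨fun hw => h.ne (by rw [hw]), ?_⟩
    rcases le_total (G.edist u (cover nb u d w').1) (G.edist u (cover nb u d w).1) with hle | hle
    · exact .inr (hforth h hle)
    · exact .inl (hforth h.symm hle)
  · rintro ⟨_, ⟨h0, h⟩ | ⟨h0, h⟩⟩
    · exact hback h0 h
    · exact (hback h0 h).symm

/-- With `k = r`, the whole finite tree is the `r`-neighbourhood of its root, so inducing on it
loses no vertex. -/
theorem edist_treeRoot_le (hd : 0 < d) {k : ℕ} (w : Fin (treeSize d r))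
    (hw : (w : ℕ) < treeSize d k) : (regularTree d r).edist (treeRoot d r) w ≤ k := by
  induction k generalizing w with
  | zero =>
    rw [treeSize_zero] at hw
    have : treeRoot d r = w := Fin.ext (by simp only [treeRoot]; omega)
    simp [this]
  | succ k ih =>
    rcases Nat.eq_zero_or_pos (w : ℕ) with h0 | h0
    · have : treeRoot d r = w := Fin.ext h0.symm
      simp [this]
    · have hp := treeParent_lt hd h0
      refine edist_le_succ_of_adj
        (ih ⟨treeParent d w, hp.trans w.2⟩ (treeParent_lt_treeSize hd hw)) ?_
      rw [regularTree, fromRel_adj]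
      exact ⟨fun h => hp.ne (congrArg Fin.val h), .inl ⟨h0, rfl⟩⟩

/-- A tree-like neighbourhood in a regular graph is isomorphic to the regular tree. -/
theorem TreeLike.exists_iso [Fintype V] [LocallyFinite G] (hd : 0 < d)
    (hG : G.IsRegularOfDegree d) (hu : TreeLike G u r) :
    ∃ (φ : Fin (treeSize d r) → V)
      (π : (regularTree d r).induce (nbhd (regularTree d r) (treeRoot d r) r) ≃g
        G.induce (nbhd G u r)),
      Function.Injective φ ∧ φ (treeRoot d r) = u ∧ ∀ v, (π v : V) = φ v := by
  obtain ⟨nb, hnb⟩ := exists_isEnum (V := V) (G := G) (d := d) (by convert hG)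
  let φ : Fin (treeSize d r) → V := fun w => (cover nb u d w).1
  have hφ : Function.Injective φ := fun w w' h => Fin.ext (cover_injOn hd hnb hu w.2 w'.2 h)
  let e : nbhd (regularTree d r) (treeRoot d r) r → nbhd G u r := fun w =>
    ⟨φ w, (cover_spec hd hnb hu le_rfl w.1.2).1⟩
  have he : Function.Bijective e := by
    refine ⟨fun w w' h => Subtype.ext (hφ (congrArg Subtype.val h)), fun x => ?_⟩
    obtain ⟨w, hw, hwx⟩ := exists_cover_eq hd hnb hu le_rfl x.2
    exact ⟨⟨⟨w, hw⟩, edist_treeRoot_le hd _ hw⟩, Subtype.ext hwx⟩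
  refine ⟨φ, ⟨Equiv.ofBijective e he, ?_⟩, hφ, ?_, fun v => rfl⟩
  · intro w w'
    exact cover_adj_iff hd hnb hu w w'
  · simp only [φ, treeRoot, cover_zero]

end Cover
-- Local decisions on a fixed regular graph
section LocalRule

variable {f : DecisionFunction} {d r n : ℕ} {G : SimpleGraph (Fin n)}

theorem DecisionFunction.IsLocal.dependsOn (hloc : f.IsLocal r) (u : Fin n)
    (G : SimpleGraph (Fin n)) : DependsOn (f.toFun le_rfl u G) (nbhd G u r) := by
  intro x y hxy
  exact hloc le_rfl le_rfl G G u u (RelIso.refl _) x y rfl fun v => hxy v v.2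

open Classical in
theorem DecisionFunction.IsLocal.exists_eq_onTree (hd : 0 < d) (hloc : f.IsLocal r)
    (hG : G.IsRegularOfDegree d) {u : Fin n} (hu : TreeLike G u r) :
    ∃ φ : Fin (treeSize d r) → Fin n, Function.Injective φ ∧
      ∀ x, f.toFun le_rfl u G x = f.onTree d r fun i => x (φ i) := by
  obtain ⟨φ, π, hφ, hroot, hπ⟩ := hu.exists_iso hd hG
  refine ⟨φ, hφ, fun x => ?_⟩
  refine (hloc le_rfl le_rfl (regularTree d r) G (treeRoot d r) u π (fun i => x (φ i)) x
    ((hπ _).trans hroot) fun v => ?_).symm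
  rw [hπ]
  rfl

/-- The event that the vertex `u` is decided `1` with both members of a correlated pair. -/
def overlapEvent (f : DecisionFunction) (G : SimpleGraph (Fin n)) (p : I) (u : Fin n) :
    Set (Fin n → I × I × I) :=
  {ω | f.toFun le_rfl u G (pairOf p ω).1 = true ∧ f.toFun le_rfl u G (pairOf p ω).2 = true}

theorem measurableSet_overlapEvent (f : DecisionFunction) (G : SimpleGraph (Fin n)) (p : I)
    (u : Fin n) : MeasurableSet (overlapEvent f G p u) :=
  ((f.measurable_toFun le_rfl u G).comp (measurable_pairOf p).fst (measurableSet_singleton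
    true)).inter ((f.measurable_toFun le_rfl u G).comp (measurable_pairOf p).snd
    (measurableSet_singleton true))

theorem dependsOn_overlapEvent (hloc : f.IsLocal r) (p : I) (u : Fin n) :
    DependsOn ((overlapEvent f G p u).indicator fun _ => (1 : ℝ)) (nbhd G u r) := by
  intro ω ω' h
  have h1 : f.toFun le_rfl u G (pairOf p ω).1 = f.toFun le_rfl u G (pairOf p ω').1 :=
    hloc.dependsOn u G fun i hi => by simp only [pairOf, h i hi]
  have h2 : f.toFun le_rfl u G (pairOf p ω).2 = f.toFun le_rfl u G (pairOf p ω').2 :=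
    hloc.dependsOn u G fun i hi => by simp only [pairOf, h i hi]
  have h3 : ω ∈ overlapEvent f G p u ↔ ω' ∈ overlapEvent f G p u := by
    change (_ ∧ _) ↔ (_ ∧ _)
    rw [h1, h2]
  by_cases h4 : ω ∈ overlapEvent f G p u
  · rw [Set.indicator_of_mem h4, Set.indicator_of_mem (h3.mp h4)]
  · rw [Set.indicator_of_notMem h4, Set.indicator_of_notMem (fun h => h4 (h3.mpr h))]

/-- The `r`-balls around vertices at distance more than `2r` are disjoint. -/
theorem indepFun_overlapEvent (hloc : f.IsLocal r) (p : I) {u v : Fin n}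
    (huv : ¬ G.edist u v ≤ (2 * r : ℕ)) :
    IndepFun ((overlapEvent f G p u).indicator fun _ => (1 : ℝ))
      ((overlapEvent f G p v).indicator fun _ => (1 : ℝ)) volume := by
  classical
  have hcoe (u : Fin n) : ((Set.toFinset (nbhd G u r) : Finset (Fin n)) : Set (Fin n)) =
      nbhd G u r := Set.coe_toFinset _
  refine indepFun_of_dependsOn (S := (nbhd G u r).toFinset) (T := (nbhd G v r).toFinset)
    (measurable_const.indicator (measurableSet_overlapEvent f G p u))
    (measurable_const.indicator (measurableSet_overlapEvent f G p v)) ?_ ?_ ?_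
  · rw [Finset.disjoint_left]
    intro w hu hv
    rw [Set.mem_toFinset] at hu hv
    apply huv
    have hv' : G.edist w v ≤ r := by rw [SimpleGraph.edist_comm]; exact hv
    refine (SimpleGraph.edist_triangle (v := w)).trans ((add_le_add hu hv').trans_eq ?_)
    push_cast
    ring
  · rw [hcoe]; exact dependsOn_overlapEvent hloc p u
  · rw [hcoe]; exact dependsOn_overlapEvent hloc p v

-- At a tree-like vertex the event is the tree event for triples reindexed by an injection, and
-- these are again i.i.d.
open Classical in
theorem measureReal_overlapEvent (hd : 0 < d) (hloc : f.IsLocal r)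
    (hG : G.IsRegularOfDegree d) (p : I) {u : Fin n} (hu : TreeLike G u r) :
    volume.real (overlapEvent f G p u) = f.overlapDensity d r p := by
  obtain ⟨φ, hφ, hf⟩ := hloc.exists_eq_onTree hd hG hu
  rw [DecisionFunction.overlapDensity, correlated_eq_map_pairOf,
    map_measureReal_apply (measurable_pairOf p) (measurableSet_onTree_pair f d r),
    ← (measurePreserving_comp_injective hφ).measureReal_preimage
      (measurable_pairOf p (measurableSet_onTree_pair f d r)).nullMeasurableSet]
  congr 1
  ext ω
  change (_ ∧ _) ↔ (_ ∧ _)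
  rw [hf, hf]
  rfl

theorem overlapDensity_mem_Icc (f : DecisionFunction) (d r : ℕ) (p : I) :
    f.overlapDensity d r p ∈ Set.Icc 0 1 :=
  ⟨measureReal_nonneg, measureReal_le_one⟩

-- Tree-like vertices contribute zero, each other vertex at most one.
open Classical in
theorem abs_sum_overlapEvent_sub_le (hd : 0 < d) (hloc : f.IsLocal r)
    (hG : G.IsRegularOfDegree d) (p : I) :
    |∑ u, volume.real (overlapEvent f G p u) - f.overlapDensity d r p * n| ≤
      ((Finset.univ.filter fun u => ¬ TreeLike G u r).card : ℝ) := by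
  have h1 : ∑ u, volume.real (overlapEvent f G p u) - f.overlapDensity d r p * n =
      ∑ u, (volume.real (overlapEvent f G p u) - f.overlapDensity d r p) := by
    simp [mul_comm]
  rw [h1, Finset.card_filter]
  push_cast
  refine (Finset.abs_sum_le_sum_abs _ _).trans (Finset.sum_le_sum fun u _ => ?_)
  split_ifs with hu
  · rw [measureReal_overlapEvent hd hloc hG p hu, sub_self, abs_zero]
  · have h2 := overlapDensity_mem_Icc f d r p
    have h3 : volume.real (overlapEvent f G p u) ≤ 1 := measureReal_le_one
    have h4 : 0 ≤ volume.real (overlapEvent f G p u) := measureReal_nonneg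
    rw [abs_le]
    constructor <;> linarith [h2.1, h2.2]

/-- The seeds for which the size of the overlap is far from its typical value. -/
def atypicalSeeds (f : DecisionFunction) (G : SimpleGraph (Fin n)) (γ ε : ℝ) :
    Set ((Fin n → I) × (Fin n → I)) :=
  {t | (((f.output le_rfl G t.1 ∩ f.output le_rfl G t.2).card : ℕ) : ℝ) ∉
    Set.Icc ((γ - ε) * n) ((γ + ε) * n)}

theorem measurableSet_atypicalSeeds (f : DecisionFunction) (G : SimpleGraph (Fin n)) (γ ε : ℝ) :
    MeasurableSet (atypicalSeeds f G γ ε) := by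
  have h : Measurable fun t : (Fin n → I) × (Fin n → I) =>
      (fun u => (f.toFun le_rfl u G t.1, f.toFun le_rfl u G t.2) : Fin n → Bool × Bool) :=
    measurable_pi_iff.mpr fun u => ((f.measurable_toFun le_rfl u G).comp measurable_fst).prodMk
      ((f.measurable_toFun le_rfl u G).comp measurable_snd)
  exact h (t := {b | ((((Finset.univ.filter fun u => (b u).1 = true) ∩
    (Finset.univ.filter fun u => (b u).2 = true)).card : ℕ) : ℝ) ∉
      Set.Icc ((γ - ε) * n) ((γ + ε) * n)}) (Set.toFinite _).measurableSet

open Classical in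
theorem correlated_atypicalSeeds_le (hd : 0 < d) (hloc : f.IsLocal r)
    (hG : G.IsRegularOfDegree d) (p : I) {ε : ℝ} (hε : 0 < ε) (hn : 0 < n)
    (hbad : ((Finset.univ.filter fun u => ¬ TreeLike G u r).card : ℝ) ≤ ε / 2 * n) :
    correlated n p (atypicalSeeds f G (f.overlapDensity d r p) ε) ≤
      ENNReal.ofReal (4 * (d + 1) ^ (2 * r) / (ε ^ 2 * n)) := by
  have hn' : (0 : ℝ) < n := by exact_mod_cast hn
  rw [correlated_eq_map_pairOf,
    Measure.map_apply (measurable_pairOf p) (measurableSet_atypicalSeeds f G _ ε)]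
  -- With `δ = εn/2` the allowed deviation `2δ` is `εn`, and each vertex has at most `(d+1)^(2r)`
  -- dependent partners.
  have key := measure_card_dist_le (μ := (volume : Measure (Fin n → I × I × I)))
    (measurableSet_overlapEvent f G p)
    (fun u => Finset.univ.filter fun v => G.edist u v ≤ (2 * r : ℕ))
    (B := (d + 1) ^ (2 * r)) (m := f.overlapDensity d r p * n) (δ := ε / 2 * n)
    (fun u => by exact_mod_cast (by convert card_filter_edist_le hG u (2 * r)))
    (fun u v huv => indepFun_overlapEvent hloc p (by simpa using huv)) (by positivity)
    ((abs_sum_overlapEvent_sub_le hd hloc hG p).trans hbad)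
  refine (measure_mono fun ω hω => ?_).trans (key.trans (le_of_eq ?_))
  · have hcard : f.output le_rfl G (pairOf p ω).1 ∩ f.output le_rfl G (pairOf p ω).2 =
        Finset.univ.filter fun u => ω ∈ overlapEvent f G p u := by
      ext u
      simp only [DecisionFunction.output, Finset.mem_inter, Finset.mem_filter, Finset.mem_univ,
        true_and]
      rfl
    have hω' : (((f.output le_rfl G (pairOf p ω).1 ∩
      f.output le_rfl G (pairOf p ω).2).card : ℕ) : ℝ) ∉
        Set.Icc ((f.overlapDensity d r p - ε) * n) ((f.overlapDensity d r p + ε) * n) := hω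
    rw [hcard] at hω'
    change 2 * (ε / 2 * n) < _
    by_contra hle
    obtain ⟨h1, h2⟩ := abs_le.mp (not_lt.mp hle)
    exact hω' ⟨by linarith, by linarith⟩
  · congr 1
    simp only [Fintype.card_fin]
    field_simp
    ring

end LocalRule

/-! ### Averaging over the random regular graph -/

section RandomGraph

instance (n : ℕ) : MeasurableSingletonClass (SimpleGraph (Fin n)) :=
  ⟨fun G => ⟨{G.Adj}, measurableSet_singleton _, by
    ext H; exact SimpleGraph.adj_inj⟩⟩

-- Markov's inequality for the number of vertices near a short cycle, written as a count over
-- graphs.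
open Classical in
theorem mul_card_regularGraphs_filter_le (d L r n : ℕ) {c : ℝ} :
    c * (((regularGraphs (Fin n) d).filter fun G : SimpleGraph (Fin n) =>
      c < ((Finset.univ.filter fun u : Fin n =>
        ∃ a b, G.edist u a ≤ r ∧ IsShortCycleEdge G L a b).card : ℝ)).card : ℝ) ≤
      ((nearShortCycle (Fin n) d L r).card : ℝ) := by
  let g : SimpleGraph (Fin n) → ℝ := fun G =>
    ((Finset.univ.filter fun u : Fin n =>
      ∃ a b, G.edist u a ≤ r ∧ IsShortCycleEdge G L a b).card : ℝ)
  have h : ((nearShortCycle (Fin n) d L r).card : ℝ) = ∑ G ∈ regularGraphs (Fin n) d, g G := by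
    rw [nearShortCycle, card_pairs]
    push_cast
    refine Finset.sum_congr rfl fun G _ => ?_
    simp only [g]
    congr
  rw [h, mul_comm, ← nsmul_eq_mul]
  exact (Finset.card_nsmul_le_sum _ g c fun G hG => (Finset.mem_filter.mp hG).2.le).trans
    (Finset.sum_le_sum_of_subset_of_nonneg (Finset.filter_subset _ _)
      fun _ _ _ => Nat.cast_nonneg _)

theorem not_treeLike_iff {V : Type*} {G : SimpleGraph V} {u : V} {r : ℕ} :
    ¬ TreeLike G u r ↔ ∃ a b, G.edist u a ≤ r ∧ IsShortCycleEdge G (2 * r + 1) a b := by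
  simp [TreeLike]

open Classical in
/-- In a random regular graph, with high probability few vertices have a neighbourhood that is not
tree-like. -/
theorem randomRegularGraph_not_treeLike_le (d r n : ℕ) {δ η : ℝ} (hδ : 0 < δ) (hη : 0 < η)
    (hn : 2 * (d + 1) ^ (2 * r + 1 + 3) < n)
    (hn' : 2 * ((d + 1) ^ (2 * r + 1) * d * d * (d + 1) ^ r) / (δ * η) ≤ (n : ℝ)) :
    randomRegularGraph d n {G | δ * n <
      ((Finset.univ.filter fun u => ¬ TreeLike G u r).card : ℝ)} ≤ ENNReal.ofReal η := by
  set A := {G : SimpleGraph (Fin n) | δ * n <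
      ((Finset.univ.filter fun u => ¬ TreeLike G u r).card : ℝ)}
  set R := {G : SimpleGraph (Fin n) | G.IsRegularOfDegree d}
  set C : ℕ := (d + 1) ^ (2 * r + 1) * d * d * (d + 1) ^ r with hC
  set M := (regularGraphs (Fin n) d).card
  set N := ((regularGraphs (Fin n) d).filter fun G => δ * n <
      ((Finset.univ.filter fun u => ¬ TreeLike G u r).card : ℝ)).card with hN
  have hn0 : (0 : ℝ) < n := by exact_mod_cast (by omega : 0 < n)
  have h1 : δ * n * N ≤ (nearShortCycle (Fin n) d (2 * r + 1) r).card := by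
    rw [hN]
    simp only [not_treeLike_iff]
    exact mul_card_regularGraphs_filter_le d (2 * r + 1) r n
  have h2 : ((nearShortCycle (Fin n) d (2 * r + 1) r).card : ℝ) ≤ 2 * M * C := by
    have h := card_nearShortCycle_mul_le (Fin n) d (2 * r + 1) r
    rw [Fintype.card_fin] at h
    -- The size assumption `hn` gives `n ≤ 2 (n - (d+1)^(2r+4))`, which costs the factor 2 and
    -- cancels `n`.
    have h3 : (nearShortCycle (Fin n) d (2 * r + 1) r).card * n ≤ 2 * M * C * n := by
      calc (nearShortCycle (Fin n) d (2 * r + 1) r).card * n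
          ≤ (nearShortCycle (Fin n) d (2 * r + 1) r).card *
            (2 * (n - (d + 1) ^ (2 * r + 1 + 3))) := Nat.mul_le_mul_left _ (by omega)
        _ = 2 * ((nearShortCycle (Fin n) d (2 * r + 1) r).card *
            (n - (d + 1) ^ (2 * r + 1 + 3))) := by ring
        _ ≤ 2 * _ := Nat.mul_le_mul_left _ h
        _ = 2 * M * C * n := by rw [hC]; ring
    exact_mod_cast Nat.le_of_mul_le_mul_right h3 (by omega)
  have h3 : (N : ℝ) ≤ η * M := by
    have h4 : 2 * (C : ℝ) ≤ n * (δ * η) := by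
      rw [hC]
      push_cast
      exact (div_le_iff₀ (by positivity)).mp hn'
    have h5 : δ * n * N ≤ δ * n * (η * M) := by
      calc δ * n * N ≤ M * (2 * C) := by linarith
        _ ≤ M * (n * (δ * η)) := by gcongr
        _ = δ * n * (η * M) := by ring
    exact le_of_mul_le_mul_left h5 (by positivity)
  have hR : R = ((regularGraphs (Fin n) d : Finset _) : Set (SimpleGraph (Fin n))) := by
    ext G
    rw [Finset.mem_coe, mem_regularGraphs]
    exact Iff.rfl
  have hRA : R ∩ A = ((regularGraphs (Fin n) d).filter fun G => δ * n <
      ((Finset.univ.filter fun u => ¬ TreeLike G u r).card : ℝ) :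
        Finset (SimpleGraph (Fin n))) := by
    rw [Finset.coe_filter, hR]
    rfl
  rw [randomRegularGraph, uniformOn, cond_apply (Set.toFinite _).measurableSet]
  change (Measure.count R)⁻¹ * Measure.count (R ∩ A) ≤ _
  rw [hRA, hR, Measure.count_apply_finset, Measure.count_apply_finset, mul_comm,
    ← div_eq_mul_inv]
  refine ENNReal.div_le_of_le_mul ?_
  rw [← ENNReal.ofReal_natCast, ← ENNReal.ofReal_natCast, ← ENNReal.ofReal_mul hη.le]
  exact ENNReal.ofReal_le_ofReal h3

theorem exists_forall_atypical_le {f : DecisionFunction} {d r : ℕ} (hd : 0 < d)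
    (hloc : f.IsLocal r) (p : I) {ε : ℝ} (hε : 0 < ε) :
    ∃ n₀ : ℕ, ∀ n : ℕ, n₀ ≤ n → Even (n * d) →
      ((randomRegularGraph d n).prod (correlated n p))
        {ω | (((f.output le_rfl ω.1 ω.2.1 ∩ f.output le_rfl ω.1 ω.2.2).card : ℕ) : ℝ) ∉
          Set.Icc ((f.overlapDensity d r p - ε) * n) ((f.overlapDensity d r p + ε) * n)} ≤
        ENNReal.ofReal ε := by
  classical
  -- `K₁` and `K₂` bound the probability of an atypical graph by `ε/2`, with both parameters equal
  -- to `ε/2`; `K₃` brings the Chebyshev bound `4(d+1)^(2r)/(ε²n)` below `ε/2`.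
  set K₁ : ℕ := 2 * (d + 1) ^ (2 * r + 1 + 3)
  set K₂ : ℝ := 2 * ((d + 1) ^ (2 * r + 1) * d * d * (d + 1) ^ r) / (ε / 2 * (ε / 2))
  set K₃ : ℝ := 8 * (d + 1) ^ (2 * r) / ε ^ 3 with hK₃
  refine ⟨K₁ + ⌈K₂⌉₊ + ⌈K₃⌉₊ + 1, fun n hn _ => ?_⟩
  have hK₂n : K₂ ≤ n := (Nat.le_ceil K₂).trans (by exact_mod_cast (by omega : ⌈K₂⌉₊ ≤ n))
  have hK₃n : K₃ ≤ n := (Nat.le_ceil K₃).trans (by exact_mod_cast (by omega : ⌈K₃⌉₊ ≤ n))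
  have hn0 : (0 : ℝ) < n := by exact_mod_cast (by omega : 0 < n)
  set S : Set (SimpleGraph (Fin n) × (Fin n → I) × (Fin n → I)) :=
    {ω | (((f.output le_rfl ω.1 ω.2.1 ∩ f.output le_rfl ω.1 ω.2.2).card : ℕ) : ℝ) ∉
      Set.Icc ((f.overlapDensity d r p - ε) * n) ((f.overlapDensity d r p + ε) * n)}
  set A := {G : SimpleGraph (Fin n) | ε / 2 * n <
      ((Finset.univ.filter fun u => ¬ TreeLike G u r).card : ℝ)} with hA
  have hfib (G : SimpleGraph (Fin n)) :
      Prod.mk G ⁻¹' S = atypicalSeeds f G (f.overlapDensity d r p) ε := rfl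
  -- Measurability holds for each fixed graph, so `S` is cut into finitely many slices.
  have hS : MeasurableSet S := by
    have : S = ⋃ G, {G} ×ˢ atypicalSeeds f G (f.overlapDensity d r p) ε := by
      ext ω
      simp only [Set.mem_iUnion, Set.mem_prod, Set.mem_singleton_iff]
      exact ⟨fun h => ⟨ω.1, rfl, h⟩, fun ⟨G, hG, h⟩ => by subst hG; exact h⟩
    rw [this]
    exact MeasurableSet.iUnion fun G =>
      (measurableSet_singleton G).prod (measurableSet_atypicalSeeds f G _ ε)
  have hreg : ∀ᵐ G ∂randomRegularGraph d n, G.IsRegularOfDegree d :=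
    ae_cond_mem (Set.toFinite {G : SimpleGraph (Fin n) | G.IsRegularOfDegree d}).measurableSet
  have hAmeas : MeasurableSet A := (Set.toFinite _).measurableSet
  have hbound : ∀ᵐ G ∂randomRegularGraph d n, correlated n p (Prod.mk G ⁻¹' S) ≤
      A.indicator 1 G + ENNReal.ofReal (ε / 2) := by
    filter_upwards [hreg] with G hG
    by_cases hGA : G ∈ A
    · rw [Set.indicator_of_mem hGA]
      exact prob_le_one.trans le_self_add
    · rw [hfib]
      refine (correlated_atypicalSeeds_le hd hloc hG p hε (by omega)
        (not_lt.mp hGA)).trans ((ENNReal.ofReal_le_ofReal ?_).trans le_add_self)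
      rw [div_le_iff₀ (by positivity)]
      rw [hK₃, div_le_iff₀ (by positivity)] at hK₃n
      nlinarith
  -- Only an inequality: the measure is zero when there is no `d`-regular graph on `n` vertices.
  have huniv : randomRegularGraph d n Set.univ ≤ 1 := by
    unfold randomRegularGraph
    exact prob_le_one
  calc ((randomRegularGraph d n).prod (correlated n p)) S
      = ∫⁻ G, correlated n p (Prod.mk G ⁻¹' S) ∂randomRegularGraph d n :=
        Measure.prod_apply hS
    _ ≤ ∫⁻ G, (A.indicator 1 G + ENNReal.ofReal (ε / 2)) ∂randomRegularGraph d n :=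
        lintegral_mono_ae hbound
    _ = randomRegularGraph d n A + ENNReal.ofReal (ε / 2) * randomRegularGraph d n Set.univ := by
        rw [lintegral_add_right _ measurable_const, lintegral_indicator_one hAmeas,
          lintegral_const]
    _ ≤ ENNReal.ofReal (ε / 2) + ENNReal.ofReal (ε / 2) * 1 := by
        refine add_le_add ?_ (mul_le_mul_right huniv _)
        exact randomRegularGraph_not_treeLike_le d r n (by positivity) (by positivity)
          (by omega) hK₂n
    _ = ENNReal.ofReal ε := by
        rw [mul_one, ← ENNReal.ofReal_add (by positivity) (by positivity), add_halves]

end RandomGraph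

end LocalAlg

open LocalAlg in
theorem theorem2p7 (d r : ℕ) (hd : 0 < d) (f : LocalAlg.DecisionFunction)
    (hind : f.IsIndependence) (hloc : f.IsLocal r) :
    Continuous (f.overlapDensity d r) ∧
    (∀ (n : ℕ) (p : I), (LocalAlg.correlated n p).map Prod.fst = volume ∧
      (LocalAlg.correlated n p).map Prod.snd = volume) ∧
    ∀ γ ∈ Set.Icc ((f.density d r) ^ 2) (f.density d r),
      ∃ p : I, f.overlapDensity d r p = γ ∧
        ∀ ε : ℝ, 0 < ε → ∃ n₀ : ℕ, ∀ n : ℕ, n₀ ≤ n → Even (n * d) →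
          ((LocalAlg.randomRegularGraph d n).prod (LocalAlg.correlated n p))
            {ω | (((f.output le_rfl ω.1 ω.2.1 ∩ f.output le_rfl ω.1 ω.2.2).card : ℕ) : ℝ) ∉
              Set.Icc ((γ - ε) * n) ((γ + ε) * n)} ≤ ENNReal.ofReal ε := by
  refine ⟨continuous_overlapDensity f d r,
    fun n p => ⟨map_fst_correlated n p, map_snd_correlated n p⟩, fun γ hγ => ?_⟩
  obtain ⟨p, rfl⟩ := exists_overlapDensity_eq f d r hγ
  exact ⟨p, rfl, fun ε hε => exists_forall_atypical_le hd hloc p hε⟩
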